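/- A (parameterized) decision problem $(P,m)$ consists of a language $P$ over a finite alphabet together with a size parameter $m$, a function from strings to $\mathbb{N}$. Write $|x|$ for the length of a string $x$. We say that $(P_1,m_1)$ is short L-$m$-reducible to $(P_2,m_2)$, written $(P_1,m_1)\leq^{\mathrm{sL}}_{m}(P_2,m_2)$, if there are a function $f$ in $\mathrm{FL}$ (that is, $f$ is polynomially bounded in length and is computed by a deterministic multi-tape Turing machine with a read-only input tape and a write-only output tape which halts on every input $x$ and uses at most $c\log|x|+d$ cells of each work tape, for constants $c,d\ge 0$, where $\log 0=0$) and a constant $k_1>0$ such that for every string $x$: (i) $x\in P_1$ if and only if $f(x)\in P_2$, and (ii) $m_2(f(x))\leq k_1 m_1(x)+k_1$. Write $(P_1,m_1)\equiv^{\mathrm{sL}}_{m}(P_2,m_2)$ if both $(P_1,m_1)\leq^{\mathrm{sL}}_{m}(P_2,m_2)$ and $(P_2,m_2)\leq^{\mathrm{sL}}_{m}(P_1,m_1)$ hold. Formulas in conjunctive normal form are written as strings in the usual way, with variable indices in binary; a 2CNF formula is one in which every clause has at most two literals. For $k\geq 1$, $\mathrm{2SAT}_k$ is the set of (codes of) satisfiable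 2CNF formulas $\phi$ such that, for each variable $v$, the number of occurrences of $v$ and $\overline{v}$ in $\phi$ is at most $k$. For a string $x$ that encodes a CNF formula, $m_{vbl}(x)$ and $m_{cls}(x)$ denote the number of distinct variables and the number of clauses appearing in it, respectively; both are $0$ if $x$ encodes no formula. **Lemma.** (1) For every $m\in\{m_{vbl},m_{cls}\}$ and every integer $k\geq 3$, $(\mathrm{2SAT}_k,m)\equiv^{\mathrm{sL}}_{m}(\mathrm{2SAT}_3,m)$. (2) $(\mathrm{2SAT}_3,m_{vbl})\equiv^{\mathrm{sL}}_{m}(\mathrm{2SAT}_3,m_{cls})$. -/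

import Mathlib

/-! ## Deterministic log-space transducers -/

namespace LogSpace

/-- A head movement. -/
inductive Move
  | left
  | stay
  | right

/-- What the input head may see: an end marker or an input letter. -/
inductive InSym (α : Type)
  | leftEnd
  | rightEnd
  | letter (a : α)

/-- A deterministic multi-tape Turing machine with a two-way read-only input tape (input alphabet
`α`, the input stands between two end markers), `tapes` many read-write work tapes that are
infinite to the right, and a write-only output tape (output alphabet `β`). A transition looks at
the state, the scanned input symbol and the scanned work symbols; `none` means that the machine
halts, otherwise it gives the new state, the move of the input head, the symbol written and the
move made on every work tape, and possibly one output letter. -/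
structure Machine (α β : Type) where
  State : Type
  finiteState : Finite State
  WorkSym : Type
  finiteWorkSym : Finite WorkSym
  blank : WorkSym
  tapes : ℕ
  start : State
  trans : State → InSym α → (Fin tapes → WorkSym) →
    Option (State × Move × (Fin tapes → WorkSym × Move) × Option β)

namespace Machine

variable {α β : Type}

/-- A configuration: state, position of the input head (`0` is the left end marker), positions of
the work heads, contents of the work tapes, and the word written on the output tape so far. -/
structure Cfg (M : Machine α β) where
  state : M.State
  inPos : ℕ
  workPos : Fin M.tapes → ℕ
  work : Fin M.tapes → ℕ → M.WorkSym
  output : List β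

/-- Cell `0` of the input tape holds the left end marker, cells `1, …, |x|` hold the letters of
`x`, and cell `|x| + 1` holds the right end marker. -/
def readInput (x : List α) : ℕ → InSym α
  | 0 => InSym.leftEnd
  | p + 1 => match x[p]? with
    | some a => InSym.letter a
    | none => InSym.rightEnd

/-- The input head never leaves the cells `0, …, n + 1`, where `n` is the length of the input. -/
def moveInput (n : ℕ) (p : ℕ) : Move → ℕ
  | Move.left => p - 1
  | Move.stay => p
  | Move.right => min (p + 1) (n + 1)

/-- A work head that is asked to move left from the leftmost cell `0` stays there. -/
def moveWork (p : ℕ) : Move → ℕ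
  | Move.left => p - 1
  | Move.stay => p
  | Move.right => p + 1

/-- At the start all work tapes are blank, the output is empty, all work heads are at the leftmost
cell and the input head is at the left end marker. -/
def init (M : Machine α β) : Cfg M where
  state := M.start
  inPos := 0
  workPos := fun _ => 0
  work := fun _ _ => M.blank
  output := []

/-- One step of the machine on input `x`; `none` if the machine has halted. -/
def next (M : Machine α β) (x : List α) (c : Cfg M) : Option (Cfg M) :=
  (M.trans c.state (readInput x c.inPos) (fun i => c.work i (c.workPos i))).map fun t =>
    { state := t.1
      inPos := moveInput x.length c.inPos t.2.1
      workPos := fun i => moveWork (c.workPos i) (t.2.2.1 i).2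
      work := fun i => Function.update (c.work i) (c.workPos i) (t.2.2.1 i).1
      output := c.output ++ t.2.2.2.toList }

/-- The configurations that occur in the computation of `M` on input `x`. -/
def Reaches (M : Machine α β) (x : List α) (c : Cfg M) : Prop :=
  Relation.ReflTransGen (fun c₁ c₂ => M.next x c₁ = some c₂) M.init c

/-- `M` halts on every input `x`, with `f x` written on the output tape. -/
def Computes (M : Machine α β) (f : List α → List β) : Prop :=
  ∀ x, ∃ c, M.Reaches x c ∧ M.next x c = none ∧ c.output = f x

/-- On every input `x`, at most `s |x|` cells of each work tape are visited (the input tape and the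
output tape are not counted). -/
def UsesSpace (M : Machine α β) (s : ℕ → ℕ) : Prop :=
  ∀ x c, M.Reaches x c → ∀ i, c.workPos i + 1 ≤ s x.length

end Machine

/-- The class FL of the polynomially bounded functions that a deterministic Turing machine computes
in space `c log |x| + d`. (`Nat.log 2 n` is the logarithm to base 2, rounded down, with
`Nat.log 2 0 = 0`; the rounding is absorbed by the constants.) -/
def FL {α β : Type} (f : List α → List β) : Prop :=
  (∃ e : ℕ, ∀ x, (f x).length ≤ x.length ^ e + e) ∧
  ∃ (M : Machine α β) (c d : ℕ), M.Computes f ∧ M.UsesSpace fun n => c * Nat.log 2 n + d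

/-- A decision problem over the alphabet `α` together with a size parameter. -/
structure ParamProblem (α : Type) where
  lang : Set (List α)
  size : List α → ℕ

/-- Short L-m-reducibility. -/
def ShortReducible {α β : Type} (P : ParamProblem α) (Q : ParamProblem β) : Prop :=
  ∃ f : List α → List β, FL f ∧ ∃ k₁ : ℕ, 0 < k₁ ∧
    ∀ x, (x ∈ P.lang ↔ f x ∈ Q.lang) ∧ Q.size (f x) ≤ k₁ * P.size x + k₁

/-- Equivalence under short L-m-reductions. -/
def ShortEquiv {α β : Type} (P : ParamProblem α) (Q : ParamProblem β) : Prop :=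
  ShortReducible P Q ∧ ShortReducible Q P

end LogSpace

/-! ## Formulas in conjunctive normal form and the problems 2SAT_k -/

namespace TwoSat

/-- The literal `x_var` (if `pos = true`) or its negation (if `pos = false`). -/
structure Literal where
  var : ℕ
  pos : Bool

/-- A clause is a disjunction of literals. -/
abbrev Clause := List Literal

/-- A formula in conjunctive normal form is a conjunction of clauses. -/
abbrev CNF := List Clause

/-- Every clause has at most two literals. -/
def IsTwoCNF (φ : CNF) : Prop := ∀ c ∈ φ, c.length ≤ 2

/-- Some truth assignment makes a literal of every clause true. -/
def Satisfiable (φ : CNF) : Prop :=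
  ∃ σ : ℕ → Bool, ∀ c ∈ φ, ∃ l ∈ c, σ l.var = l.pos

/-- The number of occurrences of `x_v` and of its negation in `φ`. -/
def occurrences (φ : CNF) (v : ℕ) : ℕ := (φ.flatten.map Literal.var).count v

/-- The number of distinct variables that appear in `φ`. -/
def numVars (φ : CNF) : ℕ := (φ.flatten.map Literal.var).toFinset.card

/-- The number of clauses of `φ`. -/
def numClauses (φ : CNF) : ℕ := φ.length

/-- The alphabet in which formulas are written: binary digits, the signs that open a positive or a
negative literal, and a symbol that closes a clause. -/
inductive Sym
  | bit (b : Bool)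
  | sign (pos : Bool)
  | endClause

/-- A literal is written as its sign followed by the binary digits of the index of its variable
(least significant digit first). -/
def encodeLiteral (l : Literal) : List Sym := Sym.sign l.pos :: l.var.bits.map Sym.bit

/-- A clause is written as the sequence of its literals, closed by the end-of-clause symbol. -/
def encodeClause (c : Clause) : List Sym := c.flatMap encodeLiteral ++ [Sym.endClause]

/-- A formula is written as the sequence of its clauses. -/
def encode (φ : CNF) : List Sym := φ.flatMap encodeClause

/-- A right-to-left scanner that recovers a formula from its code. -/
def scan : Sym → List Bool × CNF → List Bool × CNF
  | Sym.bit b, (bs, φ) => (b :: bs, φ)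
  | Sym.sign s, (bs, c :: φ) => ([], (⟨bs.foldr Nat.bit 0, s⟩ :: c) :: φ)
  | Sym.sign _, (_, []) => ([], [])
  | Sym.endClause, (_, φ) => ([], [] :: φ)

theorem foldr_bit_bits (n : ℕ) : n.bits.foldr Nat.bit 0 = n := by
  induction n using Nat.binaryRec' with
  | zero => simp
  | bit b n h ih => rw [Nat.bits_append_bit n b h]; simp [ih]

theorem foldr_scan_bits (bs : List Bool) (φ : CNF) :
    (bs.map Sym.bit).foldr scan ([], φ) = (bs, φ) := by
  induction bs with
  | nil => rfl
  | cons b bs ih => simp [ih, scan]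

theorem foldr_scan_lits (c d : Clause) (φ : CNF) :
    (c.flatMap encodeLiteral).foldr scan ([], d :: φ) = ([], (c ++ d) :: φ) := by
  induction c with
  | nil => rfl
  | cons l c ih =>
    simp [List.flatMap_cons, ih, encodeLiteral, foldr_scan_bits, scan, foldr_bit_bits]

theorem foldr_scan_encode (φ : CNF) : (encode φ).foldr scan ([], []) = ([], φ) := by
  induction φ with
  | nil => rfl
  | cons c φ ih =>
    have h : encode (c :: φ) = encodeClause c ++ encode φ := rfl
    rw [h, List.foldr_append, ih, encodeClause, List.foldr_append]
    simpa [scan] using foldr_scan_lits c [] φ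

theorem encode_injective : Function.Injective encode := by
  intro φ ψ h
  have := foldr_scan_encode φ
  rw [h, foldr_scan_encode ψ] at this
  exact (congrArg Prod.snd this).symm

open Classical in
/-- The size parameter on strings given by a numerical quantity of formulas: the value at the
formula that is encoded, and `0` for strings that encode no formula. -/
noncomputable def onStrings (g : CNF → ℕ) (x : List Sym) : ℕ :=
  if h : ∃ φ, encode φ = x then g h.choose else 0

theorem onStrings_encode (g : CNF → ℕ) (φ : CNF) : onStrings g (encode φ) = g φ := by
  have h : ∃ ψ, encode ψ = encode φ := ⟨φ, rfl⟩
  rw [onStrings, dif_pos h, encode_injective h.choose_spec]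

theorem onStrings_of_not_code (g : CNF → ℕ) (x : List Sym) (h : ¬ ∃ φ, encode φ = x) :
    onStrings g x = 0 := dif_neg h

/-- The size parameter `m_vbl`: the number of variables. -/
noncomputable def mVbl : List Sym → ℕ := onStrings numVars

/-- The size parameter `m_cls`: the number of clauses. -/
noncomputable def mCls : List Sym → ℕ := onStrings numClauses

/-- The language 2SAT_k: the codes of the satisfiable 2CNF formulas in which every variable occurs,
negated or not, at most `k` times. -/
def twoSAT (k : ℕ) : Set (List Sym) :=
  {x | ∃ φ : CNF, encode φ = x ∧ IsTwoCNF φ ∧ Satisfiable φ ∧ ∀ v, occurrences φ v ≤ k}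

end TwoSat

/-!
Replace every occurrence of a variable `v` by a fresh copy of `v`, and add the implications
`v₀ → v₁ → ⋯ → vₖ₋₁ → v₀`, which force the `k` copies to have the same value. Each copy stands at
most once in the renamed formula and exactly twice in its cycle, hence at most three times. This one
function serves for all the reductions: in a formula with nonempty clauses of at most two literals
and at most `k` occurrences of every variable, the number of variables is at most twice the number
of clauses, which is at most `k` times the number of variables, and the function enlarges both at
most by constant factors.

To find a copy for an occurrence without any bookkeeping, take copy `j` if `j` occurrences of `v`
follow in the formula, and let copy `j` be the variable `2 ^ j * (2 * v + 1)`: with the least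
significant digit first, its digits are `0 ^ j 1` followed by those of `v`, so that the code of a
literal changes by an insertion. The cycle is written at the last occurrence of `v`, the one that
takes copy `0`.

The function is computed by a program with a finite memory and finitely many pointers into the
input. The pointers are stored as numbers in the registers of a machine that can only copy, clear,
increment and compare them, and such a machine is simulated by a Turing machine with one work
tape whose cells hold the binary digits of all registers at one place value. The tape is thus no
longer than the length of the input in binary.
-/

namespace LogSpace

/-! ## Runs -/

/-- The deterministic system `step` leads from one configuration to another, and every
configuration that it leaves on the way is `good`. In the space bounds below `good` says that the
configuration is small. -/
def RunIn {C : Type} (step : C → Option C) (good : C → Prop) : C → C → Prop :=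
  Relation.ReflTransGen fun a b => good a ∧ step a = some b

namespace RunIn

variable {C : Type} {step : C → Option C} {good : C → Prop}

theorem reflTransGen {a b : C} (h : RunIn step good a b) :
    Relation.ReflTransGen (fun a b => step a = some b) a b :=
  Relation.ReflTransGen.mono (fun _ _ h => h.2) _ _ h

theorem good_of_reflTransGen {a b d : C} (h : RunIn step good a b) (hb : good b)
    (hhalt : step b = none) (hd : Relation.ReflTransGen (fun a b => step a = some b) a d) :
    good d := by
  induction h using Relation.ReflTransGen.head_induction_on with
  | refl =>
    obtain rfl | ⟨c, hc, -⟩ := hd.cases_head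
    · exact hb
    · simp [hhalt] at hc
  | head h₁ _ ih =>
    obtain rfl | ⟨c, hc, hcd⟩ := hd.cases_head
    · exact h₁.1
    · rw [h₁.2, Option.some.injEq] at hc
      exact ih (hc ▸ hcd)

end RunIn

/-! ## Register machines -/

/-- A deterministic machine with a two-way input head and finitely many registers for natural
numbers. A transition looks at the state, the scanned input symbol and the equalities between the
registers; it changes the state, moves the input head, replaces every register by another register
or by zero, possibly plus one, and possibly writes an output letter. -/
structure RegMachine (α β : Type) where
  State : Type
  finiteState : Finite State
  Reg : Type
  finiteReg : Finite Reg
  start : State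
  trans : State → InSym α → (Reg → Reg → Bool) →
    Option (State × Move × (Reg → Option Reg × Bool) × Option β)

/-- The equalities between registers that a transition can test. -/
def eqFlags {R : Type} (v : R → ℕ) : R → R → Bool := fun r s => decide (v r = v s)

/-- The new register contents: `op r` names the register that is copied to `r` (`none` for the
value zero), and whether one is added. -/
def assign {R : Type} (v : R → ℕ) (op : R → Option R × Bool) : R → ℕ :=
  fun r => (op r).1.elim 0 v + (op r).2.toNat

namespace RegMachine

variable {α β : Type}

/-- A configuration of a register machine. -/
structure Cfg (R : RegMachine α β) where
  state : R.State
  inPos : ℕ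
  reg : R.Reg → ℕ
  output : List β

/-- The start configuration. -/
def init (R : RegMachine α β) : Cfg R := ⟨R.start, 0, fun _ => 0, []⟩

/-- One step of a register machine on input `x`; `none` if the machine has halted. -/
def next (R : RegMachine α β) (x : List α) (c : Cfg R) : Option (Cfg R) :=
  (R.trans c.state (Machine.readInput x c.inPos) (eqFlags c.reg)).map fun t =>
    { state := t.1
      inPos := Machine.moveInput x.length c.inPos t.2.1
      reg := assign c.reg t.2.2.1
      output := c.output ++ t.2.2.2.toList }

/-- All registers hold at most `B`. -/
def Bounded (R : RegMachine α β) (B : ℕ) (c : Cfg R) : Prop := ∀ r, c.reg r ≤ B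

end RegMachine

/-! ## Binary addition of a carry -/

/-- The carry into digit `t` when `i` is added to `b`. -/
def carry (b : ℕ) (i : Bool) (t : ℕ) : Bool := decide (2 ^ t ≤ b % 2 ^ t + i.toNat)

theorem mod_two_pow_succ (b t : ℕ) :
    b % 2 ^ (t + 1) = b % 2 ^ t + 2 ^ t * (b.testBit t).toNat := by
  rw [Nat.mod_pow_succ, Nat.toNat_testBit]

theorem decide_mod_two_pow_succ_eq (n m t : ℕ) :
    decide (n % 2 ^ (t + 1) = m % 2 ^ (t + 1)) =
      (decide (n % 2 ^ t = m % 2 ^ t) && (n.testBit t == m.testBit t)) := by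
  have hn := Nat.mod_lt n (Nat.two_pow_pos t)
  have hm := Nat.mod_lt m (Nat.two_pow_pos t)
  rw [mod_two_pow_succ, mod_two_pow_succ]
  cases n.testBit t <;> cases m.testBit t <;> simp <;> omega

theorem carry_zero (b : ℕ) (i : Bool) : carry b i 0 = i := by
  cases i <;> simp [carry, Nat.mod_one]

theorem carry_succ (b : ℕ) (i : Bool) (t : ℕ) :
    carry b i (t + 1) = (b.testBit t && carry b i t) := by
  have h := Nat.mod_lt b (Nat.two_pow_pos t)
  have hi : i.toNat ≤ 1 := i.toNat_le
  rw [carry, carry, mod_two_pow_succ, pow_succ]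
  cases b.testBit t <;> simp <;> omega

theorem add_toNat_div_two_pow (b : ℕ) (i : Bool) (t : ℕ) :
    (b + i.toNat) / 2 ^ t = b / 2 ^ t + (carry b i t).toNat := by
  have h := Nat.mod_lt b (Nat.two_pow_pos t)
  have hi : i.toNat ≤ 1 := i.toNat_le
  have hb := Nat.div_add_mod b (2 ^ t)
  rw [Nat.div_eq_iff (Nat.two_pow_pos t), carry]
  by_cases hc : 2 ^ t ≤ b % 2 ^ t + i.toNat <;>
    simp only [hc, decide_true, decide_false, Bool.toNat_true, Bool.toNat_false, Nat.add_mul,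
      Nat.mul_comm (b / 2 ^ t)] <;> omega

theorem testBit_add_toNat (b : ℕ) (i : Bool) (t : ℕ) :
    (b + i.toNat).testBit t = (b.testBit t ^^ carry b i t) := by
  rw [Nat.testBit_eq_decide_div_mod_eq, Nat.testBit_eq_decide_div_mod_eq, add_toNat_div_two_pow]
  cases carry b i t <;> rcases Nat.mod_two_eq_zero_or_one (b / 2 ^ t) with h | h <;>
    simp [h, Nat.add_mod]

theorem carry_eq_testBit {b t : ℕ} (i : Bool) (hb : b < 2 ^ t) :
    carry b i t = (b + i.toNat).testBit t := by
  rw [testBit_add_toNat, Nat.testBit_lt_two_pow hb, Bool.false_xor]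

/-! ## Simulation of register machines by log-space machines -/

namespace RegMachine

variable {α β : Type}

/-- The control states of the machine that simulates `R`. Between two simulated steps it is
`ready`, with the state and the register equalities of `R` at hand. A simulated step is a `sweep`
over the work tape from the least significant digits on, which carries out the register operations
and computes the new equalities, followed by the way `back` to the left end. -/
inductive Phase (R : RegMachine α β)
  | boot
  | ready (q : R.State) (e : R.Reg → R.Reg → Bool)
  | sweep (q : R.State) (src : R.Reg → Option R.Reg) (carry : R.Reg → Bool)
      (e : R.Reg → R.Reg → Bool)
  | back (q : R.State) (e : R.Reg → R.Reg → Bool)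

theorem finite_phase (R : RegMachine α β) : Finite (Phase R) := by
  have := R.finiteState
  have := R.finiteReg
  let E := R.Reg → R.Reg → Bool
  let ofSum : Unit ⊕ (R.State × E) ⊕
      (R.State × (R.Reg → Option R.Reg) × (R.Reg → Bool) × E) ⊕ (R.State × E) → Phase R
    | .inl _ => .boot
    | .inr (.inl (q, e)) => .ready q e
    | .inr (.inr (.inl (q, src, c, e))) => .sweep q src c e
    | .inr (.inr (.inr (q, e))) => .back q e
  refine .of_surjective ofSum ?_
  rintro (_ | ⟨q, e⟩ | ⟨q, src, c, e⟩ | ⟨q, e⟩)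
  exacts [⟨.inl (), rfl⟩, ⟨.inr (.inl (q, e)), rfl⟩, ⟨.inr (.inr (.inl (q, src, c, e))), rfl⟩,
    ⟨.inr (.inr (.inr (q, e))), rfl⟩]

/-- The work alphabet of the simulating machine: besides the blank and a marker for the left end of
the tape, columns that hold one binary digit of every register. -/
inductive Cell (I : Type)
  | blank
  | marker
  | col (b : I → Bool)

theorem finite_cell (I : Type) [Finite I] : Finite (Cell I) := by
  let ofOption : Option (Option (I → Bool)) → Cell I
    | none => .blank
    | some none => .marker
    | some (some b) => .col b
  refine .of_surjective ofOption ?_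
  rintro (_ | _ | b)
  exacts [⟨none, rfl⟩, ⟨some none, rfl⟩, ⟨some (some b), rfl⟩]

open Classical in
/-- The column with which the number is prolonged when the carries `c` leave it: none if there are
no carries. -/
noncomputable def topCell {I : Type} (c : I → Bool) : Cell I :=
  if ∃ r, c r = true then .col c else .blank

/-- The digit copied to register `r` when `b` holds the digits of all registers; it is `false` if
the source is the constant zero. -/
def srcBit {I : Type} (b : I → Bool) (src : I → Option I) (r : I) : Bool := (src r).elim false b

/-- The transitions of the simulating machine. -/
noncomputable def simTrans (R : RegMachine α β) (p : Phase R) (a : InSym α) (w : Cell R.Reg) :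
    Option (Phase R × Move × (Cell R.Reg × Move) × Option β) :=
  match p with
  | .boot => some (.ready R.start fun _ _ => true, .stay, (.marker, .stay), none)
  | .ready q e => (R.trans q a e).map fun t =>
      (.sweep t.1 (fun r => (t.2.2.1 r).1) (fun r => (t.2.2.1 r).2) fun _ _ => true,
        t.2.1, (w, .right), t.2.2.2)
  | .sweep q src c e => match w with
    | .col b => some
        (.sweep q src (fun r => srcBit b src r && c r)
          (fun r s => e r s && ((srcBit b src r ^^ c r) == (srcBit b src s ^^ c s))),
          .stay, (.col fun r => srcBit b src r ^^ c r, .right), none)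
    | _ => some (.back q fun r s => e r s && (c r == c s), .stay, (topCell c, .left), none)
  | .back q e => match w with
    | .marker => some (.ready q e, .stay, (.marker, .stay), none)
    | w => some (.back q e, .stay, (w, .left), none)

/-- The simulating machine: its only work tape holds the binary digits of all registers, least
significant digits first. -/
noncomputable def sim (R : RegMachine α β) : Machine α β where
  State := Phase R
  finiteState := finite_phase R
  WorkSym := Cell R.Reg
  finiteWorkSym := have := R.finiteReg; finite_cell R.Reg
  blank := .blank
  tapes := 1
  start := .boot
  trans p a w := (simTrans R p a (w 0)).map fun t => (t.1, t.2.1, fun _ => t.2.2.1, t.2.2.2)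

/-- A configuration of the simulating machine, given by the phase, the positions of the input head
and of the work head, the content of the work tape, and the output. -/
def simCfg (R : RegMachine α β) (p : Phase R) (h wp : ℕ) (w : ℕ → Cell R.Reg) (out : List β) :
    Machine.Cfg (sim R) :=
  ⟨p, h, fun _ => wp, fun _ => w, out⟩

theorem next_simCfg (R : RegMachine α β) (x : List α) (p : Phase R) (h wp : ℕ)
    (w : ℕ → Cell R.Reg) (out : List β) :
    (sim R).next x (simCfg R p h wp w out) =
      (simTrans R p (Machine.readInput x h) (w wp)).map fun t =>
        simCfg R t.1 (Machine.moveInput x.length h t.2.1) (Machine.moveWork wp t.2.2.1.2)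
          (Function.update w wp t.2.2.1.1) (out ++ t.2.2.2.toList) := by
  simp only [Machine.next, sim, simCfg, Option.map_map]
  rfl

/-- At most `S` work cells are in use. -/
def Narrow (R : RegMachine α β) (S : ℕ) (c : Machine.Cfg (sim R)) : Prop :=
  ∀ i, c.workPos i + 1 ≤ S

theorem narrow_simCfg {R : RegMachine α β} {S h wp : ℕ} {p : Phase R} {w : ℕ → Cell R.Reg}
    {out : List β} (hS : wp + 1 ≤ S) : Narrow R S (simCfg R p h wp w out) :=
  fun _ => hS

/-- The tape that holds `W` digits of the numbers `v`. -/
def tapeOf {I : Type} (W : ℕ) (v : I → ℕ) : ℕ → Cell I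
  | 0 => .marker
  | t + 1 => if t < W then .col fun r => (v r).testBit t else .blank

/-- The tape during a sweep: the first `t` of the `W` digits have been replaced. -/
def mixTape {I : Type} (v v' : I → ℕ) (W t : ℕ) : ℕ → Cell I :=
  fun c => if c ≤ t then tapeOf W v' c else tapeOf W v c

theorem mixTape_zero {I : Type} (v v' : I → ℕ) (W : ℕ) : mixTape v v' W 0 = tapeOf W v := by
  funext c
  cases c <;> simp [mixTape, tapeOf]

theorem mixTape_succ {I : Type} (v v' : I → ℕ) {W t : ℕ} (ht : t < W) :
    mixTape v v' W (t + 1) =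
      Function.update (mixTape v v' W t) (t + 1) (.col fun r => (v' r).testBit t) := by
  funext c
  obtain rfl | hc := eq_or_ne c (t + 1)
  · simp [mixTape, tapeOf, ht]
  · simp only [Function.update_of_ne hc, mixTape, show c ≤ t + 1 ↔ c ≤ t by omega]

open Classical in
/-- The width of the tape after a sweep: it grows if some register now has a digit in position
`W`. -/
noncomputable def grow {I : Type} (v : I → ℕ) (W : ℕ) : ℕ :=
  if ∃ r, (v r).testBit W = true then W + 1 else W

theorem update_mixTape_topCell {I : Type} (v v' : I → ℕ) (W : ℕ) :
    Function.update (mixTape v v' W W) (W + 1) (topCell fun r => (v' r).testBit W) =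
      tapeOf (grow v' W) v' := by
  funext c
  by_cases hgrow : ∃ r, (v' r).testBit W = true <;>
    simp only [topCell, grow, hgrow, if_true, if_false]
  all_goals
    obtain rfl | hc := eq_or_ne c (W + 1)
    · simp [tapeOf]
    · rw [Function.update_of_ne hc, mixTape]
      rcases c with _ | c
      · simp [tapeOf]
      · by_cases hcW : c < W
        · simp [tapeOf, hcW, show c + 1 ≤ W by omega, show c < W + 1 by omega]
        · simp [tapeOf, hcW, show ¬ c < W + 1 by omega]

/-- `W` digits suffice for the numbers `v`, and are not too many for numbers up to `B`. -/
def Fits {I : Type} (B W : ℕ) (v : I → ℕ) : Prop := W ≤ Nat.log 2 B + 1 ∧ ∀ r, v r < 2 ^ W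

theorem fits_grow {I : Type} {B W : ℕ} {v : I → ℕ} (hW : W ≤ Nat.log 2 B + 1)
    (hv : ∀ r, v r < 2 ^ (W + 1)) (hB : ∀ r, v r ≤ B) : Fits B (grow v W) v := by
  by_cases hgrow : ∃ r, (v r).testBit W = true <;>
    simp only [Fits, grow, hgrow, if_true, if_false]
  · obtain ⟨r, hr⟩ := hgrow
    have hle : 2 ^ W ≤ B := (Nat.ge_two_pow_of_testBit hr).trans (hB r)
    exact ⟨Nat.succ_le_succ (Nat.le_log_of_pow_le one_lt_two hle), hv⟩
  · refine ⟨hW, fun r => Nat.lt_pow_two_of_testBit _ fun t ht => ?_⟩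
    obtain rfl | ht := ht.eq_or_lt
    · simpa using fun h => hgrow ⟨r, h⟩
    · exact Nat.testBit_lt_two_pow ((hv r).trans_le (Nat.pow_le_pow_right two_pos ht))

section sweep

variable {R : RegMachine α β} {S : ℕ} (x : List α) (v : R.Reg → ℕ)
  (op : R.Reg → Option R.Reg × Bool)

/-- The phase of a sweep that has processed `t` digits: the carries into digit `t`, and the
equalities of the results modulo `2 ^ t`. -/
def sweepPhase (q : R.State) (t : ℕ) : Phase R :=
  .sweep q (fun r => (op r).1) (fun r => carry ((op r).1.elim 0 v) (op r).2 t)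
    fun r s => decide (assign v op r % 2 ^ t = assign v op s % 2 ^ t)

theorem srcBit_testBit (t : ℕ) (r : R.Reg) :
    srcBit (fun r => (v r).testBit t) (fun r => (op r).1) r = ((op r).1.elim 0 v).testBit t := by
  cases h : (op r).1 <;> simp [srcBit, h]

theorem next_sweep (q : R.State) {W t : ℕ} (ht : t < W) (h : ℕ) (out : List β) :
    (sim R).next x (simCfg R (sweepPhase v op q t) h (t + 1) (mixTape v (assign v op) W t) out) =
      some (simCfg R (sweepPhase v op q (t + 1)) h (t + 2) (mixTape v (assign v op) W (t + 1))
        out) := by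
  have hcell : mixTape v (assign v op) W t (t + 1) = .col fun r => (v r).testBit t := by
    simp [mixTape, tapeOf, ht]
  have hdigit (r) : (((op r).1.elim 0 v).testBit t ^^ carry ((op r).1.elim 0 v) (op r).2 t) =
      (assign v op r).testBit t := (testBit_add_toNat ..).symm
  rw [next_simCfg, hcell, mixTape_succ _ _ ht]
  simp only [sweepPhase, simTrans, Option.map_some, srcBit_testBit, hdigit, Machine.moveInput,
    Machine.moveWork, Option.toList_none, List.append_nil, carry_succ, decide_mod_two_pow_succ_eq]

theorem sweep_run (q : R.State) {W : ℕ} (hS : W + 2 ≤ S) (h : ℕ) (out : List β) {t : ℕ}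
    (ht : t ≤ W) :
    RunIn ((sim R).next x) (Narrow R S) (simCfg R (sweepPhase v op q 0) h 1 (tapeOf W v) out)
      (simCfg R (sweepPhase v op q t) h (t + 1) (mixTape v (assign v op) W t) out) := by
  induction t with
  | zero => rw [mixTape_zero]; exact .refl
  | succ t ih =>
    exact (ih (by omega)).tail ⟨narrow_simCfg (by omega), next_sweep x v op q (by omega) h out⟩

theorem back_run (q : R.State) (e : R.Reg → R.Reg → Bool) {W t : ℕ} (hS : t + 1 ≤ S)
    (ht : t ≤ W) (h : ℕ) (out : List β) :
    RunIn ((sim R).next x) (Narrow R S) (simCfg R (.back q e) h t (tapeOf W v) out)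
      (simCfg R (.ready q e) h 0 (tapeOf W v) out) := by
  induction t with
  | zero =>
    have hcell : tapeOf W v 0 = .marker := rfl
    refine .single ⟨narrow_simCfg hS, ?_⟩
    rw [next_simCfg, hcell]
    simp only [simTrans, Option.map_some, Machine.moveInput, Machine.moveWork, Option.toList_none,
      List.append_nil]
    rw [← hcell, Function.update_eq_self]
  | succ t ih =>
    have hcell : tapeOf W v (t + 1) = .col fun r => (v r).testBit t := by
      simp [tapeOf, show t < W by omega]
    refine .head ⟨narrow_simCfg hS, ?_⟩ (ih (by omega) (by omega))
    rw [next_simCfg, hcell]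
    simp only [simTrans, Option.map_some, Machine.moveInput, Machine.moveWork, Option.toList_none,
      List.append_nil, add_tsub_cancel_right]
    rw [← hcell, Function.update_eq_self]

theorem next_sweep_top (q : R.State) {W : ℕ} (hv : ∀ r, v r < 2 ^ W) (h : ℕ) (out : List β) :
    (∀ r, assign v op r < 2 ^ (W + 1)) ∧
    (sim R).next x (simCfg R (sweepPhase v op q W) h (W + 1) (mixTape v (assign v op) W W) out) =
      some (simCfg R (.back q (eqFlags (assign v op))) h W
        (tapeOf (grow (assign v op) W) (assign v op)) out) := by
  have hsrc (r) : (op r).1.elim 0 v < 2 ^ W := by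
    cases (op r).1 with
    | none => exact Nat.two_pow_pos W
    | some s => exact hv s
  have hlt (r) : assign v op r < 2 ^ (W + 1) := by
    have := hsrc r
    have := (op r).2.toNat_le
    rw [assign, pow_succ]
    omega
  have hcarry (r) : carry ((op r).1.elim 0 v) (op r).2 W = (assign v op r).testBit W :=
    carry_eq_testBit _ (hsrc r)
  have hflags : (fun r s => decide (assign v op r % 2 ^ W = assign v op s % 2 ^ W) &&
      ((assign v op r).testBit W == (assign v op s).testBit W)) = eqFlags (assign v op) := by
    funext r s
    rw [← decide_mod_two_pow_succ_eq, Nat.mod_eq_of_lt (hlt r), Nat.mod_eq_of_lt (hlt s), eqFlags]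
  have hcell : mixTape v (assign v op) W W (W + 1) = .blank := by simp [mixTape, tapeOf]
  refine ⟨hlt, ?_⟩
  rw [next_simCfg, hcell]
  simp only [sweepPhase, simTrans, Option.map_some, hcarry, hflags, Machine.moveInput,
    Machine.moveWork, Option.toList_none, List.append_nil, add_tsub_cancel_right,
    update_mixTape_topCell]

end sweep

/-- The simulating machine between two simulated steps, with `W` digits on the work tape. -/
def readyCfg {R : RegMachine α β} (c : Cfg R) (W : ℕ) : Machine.Cfg (sim R) :=
  simCfg R (.ready c.state (eqFlags c.reg)) c.inPos 0 (tapeOf W c.reg) c.output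

theorem next_readyCfg {R : RegMachine α β} (x : List α) (c : Cfg R) (W : ℕ) :
    (sim R).next x (readyCfg c W) =
      (R.trans c.state (Machine.readInput x c.inPos) (eqFlags c.reg)).map fun t =>
        simCfg R (sweepPhase c.reg t.2.2.1 t.1 0) (Machine.moveInput x.length c.inPos t.2.1) 1
          (tapeOf W c.reg) (c.output ++ t.2.2.2.toList) := by
  simp [readyCfg, next_simCfg, simTrans, sweepPhase, carry_zero, Nat.mod_one, Machine.moveWork,
    Option.map_map, Function.comp_def]

theorem sim_step {R : RegMachine α β} {x : List α} {c c' : Cfg R} {S W B : ℕ}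
    (hS : Nat.log 2 B + 3 ≤ S) (hfits : Fits B W c.reg) (hB : R.Bounded B c')
    (hstep : R.next x c = some c') :
    ∃ W', Fits B W' c'.reg ∧
      RunIn ((sim R).next x) (Narrow R S) (readyCfg c W) (readyCfg c' W') := by
  rw [next, Option.map_eq_some_iff] at hstep
  obtain ⟨⟨q, move, op, o⟩, htrans, rfl⟩ := hstep
  obtain ⟨hW, hv⟩ := hfits
  obtain ⟨hlt, htop⟩ := next_sweep_top x c.reg op q hv (Machine.moveInput x.length c.inPos move)
    (c.output ++ o.toList)
  have hWgrow : W ≤ grow (assign c.reg op) W := by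
    rw [grow]; split_ifs <;> omega
  refine ⟨_, fits_grow hW hlt hB, ?_⟩
  refine .head ⟨narrow_simCfg (by omega), by rw [next_readyCfg, htrans, Option.map_some]⟩ ?_
  refine (sweep_run x c.reg op q (by omega) _ _ le_rfl).trans ?_
  exact .head ⟨narrow_simCfg (by omega), htop⟩ (back_run x _ q _ (by omega) hWgrow _ _)

theorem next_init_sim (R : RegMachine α β) (x : List α) :
    (sim R).next x (sim R).init = some (readyCfg R.init 0) := by
  change (sim R).next x (simCfg R .boot 0 0 (fun _ => .blank) []) = _
  have htape : Function.update (fun _ => .blank) 0 .marker = tapeOf 0 R.init.reg := by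
    funext t
    cases t <;> simp [tapeOf]
  rw [next_simCfg, readyCfg, ← htape]
  simp only [simTrans, Option.map_some, Machine.moveInput, Machine.moveWork, init,
    Option.toList_none, List.append_nil]
  rfl

theorem sim_run {R : RegMachine α β} {x : List α} {c : Cfg R} {S B : ℕ}
    (hS : Nat.log 2 B + 3 ≤ S) (hrun : RunIn (R.next x) (R.Bounded B) R.init c)
    (hc : R.Bounded B c) :
    ∃ W, Fits B W c.reg ∧ RunIn ((sim R).next x) (Narrow R S) (sim R).init (readyCfg c W) := by
  induction hrun with
  | refl =>
    exact ⟨0, ⟨by omega, by simp [init]⟩,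
      .single ⟨narrow_simCfg (wp := 0) (by omega), next_init_sim R x⟩⟩
  | tail _ hstep ih =>
    obtain ⟨W, hfits, hrun⟩ := ih hstep.1
    obtain ⟨W', hfits', hrun'⟩ := sim_step hS hfits hc hstep.2
    exact ⟨W', hfits', hrun.trans hrun'⟩

theorem fl_of_run (R : RegMachine α β) (f : List α → List β)
    (hlen : ∃ e : ℕ, ∀ x, (f x).length ≤ x.length ^ e + e)
    (hrun : ∀ x, ∃ c, RunIn (R.next x) (R.Bounded x.length) R.init c ∧ R.Bounded x.length c ∧
      R.next x c = none ∧ c.output = f x) : FL f := by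
  have hsim (x) : ∃ c, RunIn ((sim R).next x) (Narrow R (1 * Nat.log 2 x.length + 3))
      (sim R).init c ∧ Narrow R (1 * Nat.log 2 x.length + 3) c ∧ (sim R).next x c = none ∧
      c.output = f x := by
    obtain ⟨c, hrun, hbounded, hhalt, hout⟩ := hrun x
    obtain ⟨W, -, hW⟩ := sim_run (S := 1 * Nat.log 2 x.length + 3) (by omega) hrun hbounded
    rw [next, Option.map_eq_none_iff] at hhalt
    exact ⟨_, hW, narrow_simCfg (by omega), by rw [next_readyCfg, hhalt, Option.map_none], hout⟩
  refine ⟨hlen, sim R, 1, 3, fun x => ?_, fun x d hd => ?_⟩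
  · obtain ⟨c, hrun, -, hhalt, hout⟩ := hsim x
    exact ⟨c, hrun.reflTransGen, hhalt, hout⟩
  · obtain ⟨c, hrun, hnarrow, hhalt, -⟩ := hsim x
    exact hrun.good_of_reflTransGen hnarrow hhalt hd

end RegMachine

/-! ## Pointer programs -/

/-- Programs with a finite memory `σ` and pointers `I` into the input. A pointer is represented by
the suffix of the input that it points to. `act i g` looks at the memory and at the letter under
pointer `i` (`none` at the end of the input), changes the memory, possibly advances the pointer and
possibly writes an output letter; `copy i j` moves pointer `i` to pointer `j`; `branch i b p q`
and `loop i b p` test the memory and the letter under pointer `i` by `b`. -/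
inductive Prog (α β I σ : Type)
  | act (i : I) (g : σ → Option α → σ × Bool × Option β)
  | copy (i j : I)
  | seq (p q : Prog α β I σ)
  | branch (i : I) (b : σ → Option α → Bool) (p q : Prog α β I σ)
  | loop (i : I) (b : σ → Option α → Bool) (p : Prog α β I σ)

/-- The state of the computation of a program. -/
structure St (α β I σ : Type) where
  mem : σ
  ptr : I → List α
  out : List β

namespace St

variable {α β I σ : Type}

/-- The outcome of a test. -/
def test (s : St α β I σ) (i : I) (b : σ → Option α → Bool) : Bool := b s.mem (s.ptr i).head?

/-- The effect of the instruction `copy i j`. -/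
def copy [DecidableEq I] (s : St α β I σ) (i j : I) : St α β I σ :=
  { s with ptr := Function.update s.ptr i (s.ptr j) }

/-- The effect of the instruction `act i g`. -/
def act [DecidableEq I] (s : St α β I σ) (i : I) (g : σ → Option α → σ × Bool × Option β) :
    St α β I σ :=
  let r := g s.mem (s.ptr i).head?
  ⟨r.1, if r.2.1 then Function.update s.ptr i (s.ptr i).tail else s.ptr, s.out ++ r.2.2.toList⟩

end St

/-- `Exec p s t`: the program `p`, started in the state `s`, terminates in the state `t`. -/
inductive Exec {α β I σ : Type} [DecidableEq I] :
    Prog α β I σ → St α β I σ → St α β I σ → Prop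
  | act (i g s) : Exec (.act i g) s (s.act i g)
  | copy (i j s) : Exec (.copy i j) s (s.copy i j)
  | seq {p q s t u} : Exec p s t → Exec q t u → Exec (.seq p q) s u
  | branch_true {i b p q s t} : s.test i b = true → Exec p s t → Exec (.branch i b p q) s t
  | branch_false {i b p q s t} : s.test i b = false → Exec q s t → Exec (.branch i b p q) s t
  | loop_false {i b p s} : s.test i b = false → Exec (.loop i b p) s s
  | loop_true {i b p s t u} : s.test i b = true → Exec p s t → Exec (.loop i b p) t u →
      Exec (.loop i b p) s u

/-! ## Compilation of pointer programs to register machines -/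

namespace Prog

variable {α β I σ Q : Type}

/-- The control points of a program. Reading the letter under a pointer takes two of them: at
`false` the input head is rewound, at `true` it walks to the pointer. -/
def Point : Prog α β I σ → Type
  | act _ _ => Bool
  | copy _ _ => Unit
  | seq p q => p.Point ⊕ q.Point
  | branch _ _ p q => Bool ⊕ p.Point ⊕ q.Point
  | loop _ _ p => Bool ⊕ p.Point

theorem finite_point (p : Prog α β I σ) : Finite p.Point := by
  induction p with
  | act => exact inferInstanceAs (Finite Bool)
  | copy => exact inferInstanceAs (Finite Unit)
  | seq p q ihp ihq => exact inferInstanceAs (Finite (p.Point ⊕ q.Point))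
  | branch i b p q ihp ihq => exact inferInstanceAs (Finite (Bool ⊕ p.Point ⊕ q.Point))
  | loop i b p ih => exact inferInstanceAs (Finite (Bool ⊕ p.Point))

/-- The control point at which a program starts. -/
def entry : (p : Prog α β I σ) → p.Point
  | act _ _ => false
  | copy _ _ => ()
  | seq p _ => .inl p.entry
  | branch _ _ _ _ => .inl false
  | loop _ _ _ => .inl false

/-- The input letter that a symbol of the input tape stands for. -/
def letter? : InSym α → Option α
  | .letter a => some a
  | _ => none

/-- What a transition of a compiled program does: new control point and memory, head movement,
register operations, output. Register `some i` holds the position of pointer `i`, and register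
`none` counts the cells that the input head has passed. -/
abbrev Action (β I σ Q : Type) : Type :=
  (Q × σ) × Move × (Option I → Option (Option I) × Bool) × Option β

/-- The register operations that leave everything unchanged. -/
def keep : Option I → Option (Option I) × Bool := fun r => (some r, false)

/-- Read the letter under pointer `i`, with the control points `rewind` and `walk`, and proceed
with `use`. -/
def fetch [DecidableEq I] (i : I) (rewind walk : Q) (use : Option α → Action β I σ Q) (m : σ)
    (a : InSym α) (e : Option I → Option I → Bool) : Bool → Action β I σ Q
  | false => match a with
    | .leftEnd => ((walk, m), .right, Function.update keep none (none, false), none)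
    | _ => ((rewind, m), .left, keep, none)
  | true =>
    if e none (some i) then use (letter? a)
    else ((walk, m), .right, Function.update keep none (some none, true), none)

/-- The transitions of a program whose control points are embedded by `ι` into those of a larger
program and which continues at `exit`. -/
def trans [DecidableEq I] : (p : Prog α β I σ) → (p.Point → Q) → Q → p.Point → σ → InSym α →
    (Option I → Option I → Bool) → Action β I σ Q
  | act i g, ι, exit, z, m, a, e =>
    fetch i (ι false) (ι true) (fun a =>
      let r := g m a
      ((exit, r.1), .stay,
        if r.2.1 && a.isSome then Function.update keep (some i) (some (some i), true) else keep,
        r.2.2)) m a e z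
  | copy i j, _, exit, _, m, _, _ =>
    ((exit, m), .stay, Function.update keep (some i) (some (some j), false), none)
  | seq p q, ι, exit, z, m, a, e => match z with
    | .inl z => p.trans (ι ∘ .inl) (ι (.inr q.entry)) z m a e
    | .inr z => q.trans (ι ∘ .inr) exit z m a e
  | branch i b p q, ι, exit, z, m, a, e => match z with
    | .inl z => fetch i (ι (.inl false)) (ι (.inl true)) (fun a =>
        ((ι (.inr (if b m a then .inl p.entry else .inr q.entry)), m), .stay, keep, none)) m a e z
    | .inr (.inl z) => p.trans (ι ∘ .inr ∘ .inl) exit z m a e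
    | .inr (.inr z) => q.trans (ι ∘ .inr ∘ .inr) exit z m a e
  | loop i b p, ι, exit, z, m, a, e => match z with
    | .inl z => fetch i (ι (.inl false)) (ι (.inl true)) (fun a =>
        ((if b m a then ι (.inr p.entry) else exit, m), .stay, keep, none)) m a e z
    | .inr z => p.trans (ι ∘ .inr) (ι (.inl false)) z m a e

/-- The register machine of a program with initial memory `m₀`. It halts at the control point
`none`. -/
def machine [DecidableEq I] [Finite I] [Finite σ] (p : Prog α β I σ) (m₀ : σ) :
    RegMachine α β where
  State := Option p.Point × σ
  finiteState := have := p.finite_point; inferInstance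
  Reg := Option I
  finiteReg := inferInstance
  start := (some p.entry, m₀)
  trans s a e := s.1.map fun z => p.trans some none z s.2 a e

/-- A configuration of the machine of a program, given by the control point, the memory, the
position of the input head, the registers and the output. -/
def cfg [DecidableEq I] [Finite I] [Finite σ] (p : Prog α β I σ) (m₀ : σ) (q : Option p.Point)
    (m : σ) (pos : ℕ) (v : Option I → ℕ) (out : List β) : (p.machine m₀).Cfg :=
  ⟨(q, m), pos, v, out⟩

theorem assign_keep (v : Option I → ℕ) : assign v keep = v := rfl

theorem assign_update_keep [DecidableEq I] (v : Option I → ℕ) (r : Option I)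
    (o : Option (Option I) × Bool) :
    assign v (Function.update keep r o) = Function.update v r (o.1.elim 0 v + o.2.toNat) := by
  funext s
  obtain rfl | hs := eq_or_ne s r
  · simp [assign]
  · simp [assign, hs, keep]

theorem letter?_readInput (x : List α) (u : ℕ) :
    letter? (Machine.readInput x (u + 1)) = (x.drop u).head? := by
  rw [Machine.readInput, List.head?_drop]
  cases x[u]? <;> rfl

/-- The registers `v` are positions of the input `x`, and register `some i` represents the pointer
`ptr i`. -/
def Tracks (x : List α) (v : Option I → ℕ) (ptr : I → List α) : Prop :=
  (∀ r, v r ≤ x.length) ∧ ∀ i, ptr i = x.drop (v (some i))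

namespace Tracks

variable {x : List α} {v : Option I → ℕ} {ptr : I → List α}

theorem update_none [DecidableEq I] (h : Tracks x v ptr) {u : ℕ} (hu : u ≤ x.length) :
    Tracks x (Function.update v none u) ptr := by
  refine ⟨fun r => ?_, fun i => ?_⟩
  · obtain rfl | hr := eq_or_ne r none
    · simpa using hu
    · simpa [hr] using h.1 r
  · simpa using h.2 i

theorem update_some [DecidableEq I] (h : Tracks x v ptr) (i : I) {u : ℕ} (hu : u ≤ x.length) :
    Tracks x (Function.update v (some i) u) (Function.update ptr i (x.drop u)) := by
  refine ⟨fun r => ?_, fun j => ?_⟩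
  · obtain rfl | hr := eq_or_ne r (some i)
    · simpa using hu
    · simpa [hr] using h.1 r
  · obtain rfl | hj := eq_or_ne j i
    · simp
    · simpa [hj] using h.2 j

theorem advance [DecidableEq I] (h : Tracks x v ptr) {i : I} (hi : ptr i ≠ []) :
    Tracks x (Function.update v (some i) (v (some i) + 1))
      (Function.update ptr i (ptr i).tail) := by
  rw [h.2 i, Ne, List.drop_eq_nil_iff, not_le] at hi
  rw [h.2 i, List.tail_drop]
  exact h.update_some i hi

end Tracks

section simulation

variable [DecidableEq I] [Finite I] [Finite σ] {P : Prog α β I σ} {m₀ : σ} {x : List α}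

/-- At the control points `ι z` the machine of `P` makes the transitions `tr z`. -/
def Hosts (P : Prog α β I σ) {Z : Type} (ι : Z → Option P.Point)
    (tr : Z → σ → InSym α → (Option I → Option I → Bool) → Action β I σ (Option P.Point)) : Prop :=
  ∀ z m a e, (ι z).map (fun z => P.trans some none z m a e) = some (tr z m a e)

theorem next_of_hosts {Z : Type} {ι : Z → Option P.Point}
    {tr : Z → σ → InSym α → (Option I → Option I → Bool) → Action β I σ (Option P.Point)}
    (h : Hosts P ι tr) (x : List α) (z : Z) (m : σ) (pos : ℕ) (v : Option I → ℕ) (out : List β) :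
    (P.machine m₀).next x (cfg P m₀ (ι z) m pos v out) =
      let r := tr z m (Machine.readInput x pos) (eqFlags v)
      some (cfg P m₀ r.1.1 r.1.2 (Machine.moveInput x.length pos r.2.1) (assign v r.2.2.1)
        (out ++ r.2.2.2.toList)) := by
  have hmap := congrArg (Option.map fun r => cfg P m₀ r.1.1 r.1.2
    (Machine.moveInput x.length pos r.2.1) (assign v r.2.2.1) (out ++ r.2.2.2.toList))
    (h z m (Machine.readInput x pos) (eqFlags v))
  exact hmap

/-- The runs of the machine of `P` in which all registers hold positions of the input. -/
abbrev Run (P : Prog α β I σ) (m₀ : σ) (x : List α) :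
    (P.machine m₀).Cfg → (P.machine m₀).Cfg → Prop :=
  RunIn ((P.machine m₀).next x) ((P.machine m₀).Bounded x.length)

section fetch

variable {ι : Bool → Option P.Point} {i : I}
  {use : σ → Option α → Action β I σ (Option P.Point)}
  {s : St α β I σ} {v : Option I → ℕ}

theorem rewind_run
    (h : Hosts P ι fun z m a e => fetch i (ι false) (ι true) (use m) m a e z)
    (hv : Tracks x v s.ptr) (pos : ℕ) :
    Run P m₀ x (cfg P m₀ (ι false) s.mem pos v s.out)
      (cfg P m₀ (ι true) s.mem 1 (Function.update v none 0) s.out) := by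
  induction pos with
  | zero =>
    refine .single ⟨hv.1, ?_⟩
    rw [next_of_hosts h]
    simp [fetch, Machine.readInput, Machine.moveInput, assign_update_keep]
  | succ pos ih =>
    refine .head ⟨hv.1, ?_⟩ ih
    rw [next_of_hosts h, Machine.readInput]
    cases x[pos]? <;> simp [fetch, Machine.moveInput, assign_keep]

theorem walk_run
    (h : Hosts P ι fun z m a e => fetch i (ι false) (ι true) (use m) m a e z)
    (hv : Tracks x v s.ptr) {t : ℕ} (ht : t ≤ v (some i)) :
    Run P m₀ x (cfg P m₀ (ι true) s.mem 1 (Function.update v none 0) s.out)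
      (cfg P m₀ (ι true) s.mem (t + 1) (Function.update v none t) s.out) := by
  induction t with
  | zero => exact .refl
  | succ t ih =>
    have hti : t < v (some i) := ht
    have hvi := hv.1 (some i)
    have hne : eqFlags (Function.update v none t) none (some i) = false := by
      simpa [eqFlags] using hti.ne
    refine (ih hti.le).tail ⟨(hv.update_none (by omega)).1, ?_⟩
    rw [next_of_hosts h]
    simp [fetch, hne, Machine.moveInput, assign_update_keep, show t + 1 ≤ x.length by omega]

theorem fetch_run
    (h : Hosts P ι fun z m a e => fetch i (ι false) (ι true) (use m) m a e z)
    (hv : Tracks x v s.ptr) (pos : ℕ) :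
    let r := use s.mem (s.ptr i).head?
    Run P m₀ x (cfg P m₀ (ι false) s.mem pos v s.out)
      (cfg P m₀ r.1.1 r.1.2 (Machine.moveInput x.length (v (some i) + 1) r.2.1)
        (assign (Function.update v none (v (some i))) r.2.2.1) (s.out ++ r.2.2.2.toList)) := by
  refine ((rewind_run h hv pos).trans (walk_run h hv le_rfl)).tail
    ⟨(hv.update_none (hv.1 _)).1, ?_⟩
  rw [next_of_hosts h, hv.2 i, ← letter?_readInput]
  simp [fetch, eqFlags]

end fetch

/-- From the state `s` at the control point `q` the machine of `P` gets to the state `t` at the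
control point `q'`. -/
def Leads (P : Prog α β I σ) (m₀ : σ) (x : List α) (q : Option P.Point) (s : St α β I σ)
    (q' : Option P.Point) (t : St α β I σ) : Prop :=
  ∀ pos v, Tracks x v s.ptr → ∃ pos' v', Tracks x v' t.ptr ∧
    Run P m₀ x (cfg P m₀ q s.mem pos v s.out) (cfg P m₀ q' t.mem pos' v' t.out)

theorem Leads.trans {q₁ q₂ q₃ : Option P.Point} {s₁ s₂ s₃ : St α β I σ}
    (h : Leads P m₀ x q₁ s₁ q₂ s₂) (h' : Leads P m₀ x q₂ s₂ q₃ s₃) :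
    Leads P m₀ x q₁ s₁ q₃ s₃ := by
  intro pos v hv
  obtain ⟨pos', v', hv', hrun⟩ := h pos v hv
  obtain ⟨pos'', v'', hv'', hrun'⟩ := h' pos' v' hv'
  exact ⟨pos'', v'', hv'', hrun.trans hrun'⟩

theorem leads_of_fetch {ι : Bool → Option P.Point} {i : I}
    {target : σ → Option α → Option P.Point}
    (h : Hosts P ι fun z m a e =>
      fetch i (ι false) (ι true) (fun a => ((target m a, m), .stay, keep, none)) m a e z)
    (s : St α β I σ) : Leads P m₀ x (ι false) s (target s.mem (s.ptr i).head?) s := by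
  intro pos v hv
  have hrun := fetch_run (m₀ := m₀) h hv pos
  simp only [Option.toList_none, List.append_nil] at hrun
  exact ⟨_, _, hv.update_none (hv.1 (some i)), hrun⟩

theorem leads_act {i : I} {g : σ → Option α → σ × Bool × Option β}
    {ι : (act i g : Prog α β I σ).Point → Option P.Point} {exit : Option P.Point}
    (h : Hosts P ι ((act i g).trans ι exit)) (s : St α β I σ) :
    Leads P m₀ x (ι (act i g : Prog α β I σ).entry) s exit (s.act i g) := by
  intro pos v hv
  have hrun := fetch_run (m₀ := m₀) (ι := ι) h hv pos
  refine ⟨_, _, ?_, hrun⟩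
  have hu := hv.update_none (hv.1 (some i))
  simp only [St.act]
  obtain hnil | hne := eq_or_ne (s.ptr i) []
  · have hptr : Function.update s.ptr i [] = s.ptr := by rw [← hnil, Function.update_eq_self]
    simpa [hnil, hptr, assign_keep] using hu
  · cases hadv : (g s.mem (s.ptr i).head?).2.1
    · simpa [assign_keep] using hu
    · simpa [hne, assign_update_keep] using hu.advance hne

theorem leads_copy {i j : I} {ι : (copy i j : Prog α β I σ).Point → Option P.Point}
    {exit : Option P.Point} (h : Hosts P ι ((copy i j).trans ι exit)) (s : St α β I σ) :
    Leads P m₀ x (ι (copy i j : Prog α β I σ).entry) s exit (s.copy i j) := by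
  intro pos v hv
  have htracks := hv.update_some i (hv.1 (some j))
  rw [← hv.2 j] at htracks
  refine ⟨pos, _, htracks, .single ⟨hv.1, ?_⟩⟩
  rw [next_of_hosts h]
  simp [trans, assign_update_keep, Machine.moveInput, St.copy]

theorem leads_branch {i : I} {b : σ → Option α → Bool} {p q : Prog α β I σ}
    {ι : (branch i b p q).Point → Option P.Point} {exit : Option P.Point}
    (h : Hosts P ι ((branch i b p q).trans ι exit)) (s : St α β I σ) :
    Leads P m₀ x (ι (branch i b p q).entry) s
      (ι (.inr (if s.test i b then .inl p.entry else .inr q.entry))) s :=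
  leads_of_fetch (ι := ι ∘ .inl)
    (target := fun m a => ι (.inr (if b m a then .inl p.entry else .inr q.entry)))
    (fun z => h (.inl z)) s

theorem leads_loop {i : I} {b : σ → Option α → Bool} {p : Prog α β I σ}
    {ι : (loop i b p).Point → Option P.Point} {exit : Option P.Point}
    (h : Hosts P ι ((loop i b p).trans ι exit)) (s : St α β I σ) :
    Leads P m₀ x (ι (loop i b p).entry) s (if s.test i b then ι (.inr p.entry) else exit) s :=
  leads_of_fetch (ι := ι ∘ .inl) (target := fun m a => if b m a then ι (.inr p.entry) else exit)
    (fun z => h (.inl z)) s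

theorem leads_of_exec {p : Prog α β I σ} {s t : St α β I σ} (hexec : Exec p s t)
    {ι : p.Point → Option P.Point} {exit : Option P.Point} (h : Hosts P ι (p.trans ι exit)) :
    Leads P m₀ x (ι p.entry) s exit t := by
  induction hexec generalizing exit with
  | act i g s => exact leads_act h s
  | copy i j s => exact leads_copy h s
  | seq _ _ ihp ihq => exact (ihp fun z => h (.inl z)).trans (ihq fun z => h (.inr z))
  | @branch_true i b p q s t htest _ ih =>
    have htarget := leads_branch (m₀ := m₀) (x := x) h s
    rw [htest, if_pos rfl] at htarget
    exact htarget.trans (ih fun z => h (.inr (.inl z)))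
  | @branch_false i b p q s t htest _ ih =>
    have htarget := leads_branch (m₀ := m₀) (x := x) h s
    rw [htest, if_neg Bool.false_ne_true] at htarget
    exact htarget.trans (ih fun z => h (.inr (.inr z)))
  | @loop_false i b p s htest =>
    have htarget := leads_loop (m₀ := m₀) (x := x) h s
    rwa [htest, if_neg Bool.false_ne_true] at htarget
  | @loop_true i b p s t u htest _ _ ihp ihloop =>
    have htarget := leads_loop (m₀ := m₀) (x := x) h s
    rw [htest, if_pos rfl] at htarget
    exact (htarget.trans (ihp fun z => h (.inr z))).trans (ihloop h)

end simulation

theorem fl_of_exec [DecidableEq I] [Finite I] [Finite σ] (p : Prog α β I σ) (m₀ : σ)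
    (f : List α → List β) (hlen : ∃ e : ℕ, ∀ x, (f x).length ≤ x.length ^ e + e)
    (hexec : ∀ x, ∃ t, Exec p ⟨m₀, fun _ => x, []⟩ t ∧ t.out = f x) : FL f := by
  refine RegMachine.fl_of_run (p.machine m₀) f hlen fun x => ?_
  obtain ⟨t, hp, hout⟩ := hexec x
  have hosts : Hosts p some (p.trans some none) := fun _ _ _ _ => rfl
  have hinit : Tracks x (fun _ : Option I => 0) fun _ => x := ⟨fun _ => zero_le, fun _ => rfl⟩
  obtain ⟨pos, v, hv, hrun⟩ := leads_of_exec (m₀ := m₀) hp hosts 0 _ hinit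
  exact ⟨_, hrun, hv.1, rfl, hout⟩

end Prog

end LogSpace

namespace TwoSat

open LogSpace

/-! ## The reduction on strings -/

/-- The suffixes of a string that follow its signs: one for each occurrence of a variable in a
code, beginning with the digits of the variable. -/
def signTails : List Sym → List (List Sym)
  | [] => []
  | Sym.sign _ :: ys => ys :: signTails ys
  | Sym.bit _ :: ys => signTails ys
  | Sym.endClause :: ys => signTails ys

/-- The binary digits at the beginning of a string. -/
def leadingBits : List Sym → List Bool
  | Sym.bit b :: ys => b :: leadingBits ys
  | _ => []

/-- The number of occurrences in `ys` of the variable whose digits stand at the beginning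
of `ys`. -/
def laterCount (ys : List Sym) : ℕ := ((signTails ys).map leadingBits).count (leadingBits ys)

/-- The digits of the number `2 ^ j`. -/
def unary (j : ℕ) : List Sym := List.replicate j (Sym.bit false) ++ [Sym.bit true]

/-- The given string, with every occurrence of a variable replaced by a copy of the variable. The
number of the copy is the number of later occurrences, but at most `k`; its digits are put in front
of the digits of the variable. -/
def renamed (k : ℕ) : List Sym → List Sym
  | [] => []
  | Sym.sign s :: ys => Sym.sign s :: unary (min k (laterCount ys)) ++ renamed k ys
  | Sym.bit b :: ys => Sym.bit b :: renamed k ys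
  | Sym.endClause :: ys => Sym.endClause :: renamed k ys

/-- The code of the clause that says that copy `i` of the variable with digits `w` implies
copy `j`. -/
def implCode (w : List Bool) (i j : ℕ) : List Sym :=
  Sym.sign false :: unary i ++ w.map Sym.bit ++
    (Sym.sign true :: unary j ++ w.map Sym.bit ++ [Sym.endClause])

/-- The code of the clauses that say that the `k` copies of the variable with digits `w` are
equivalent: each of them implies the next one, cyclically. -/
def cycleCode (k : ℕ) (w : List Bool) : List Sym :=
  (List.range k).flatMap fun t => implCode w t ((t + 1) % k)

/-- The cycles of implications for all variables, in the order of their last occurrences. -/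
def cycles (k : ℕ) (ys : List Sym) : List Sym :=
  (signTails ys).flatMap fun zs => if laterCount zs = 0 then cycleCode k (leadingBits zs) else []

/-- Every variable occurs at most `k` times. -/
def FewOccurrences (k : ℕ) (ys : List Sym) : Prop := ∀ zs ∈ signTails ys, laterCount zs < k

instance (k : ℕ) (ys : List Sym) : Decidable (FewOccurrences k ys) :=
  inferInstanceAs (Decidable (∀ zs ∈ signTails ys, laterCount zs < k))

/-- A finite automaton that accepts the codes of formulas with one or two literals in every clause.
A state consists of the number of literals seen in the current clause and of the information whether
the last symbol is the digit zero, which is the last digit of no number. -/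
def syntaxStep : Option (Fin 3 × Bool) → Sym → Option (Fin 3 × Bool)
  | none, _ => none
  | some (n, _), Sym.bit b => if n = 0 then none else some (n, !b)
  | some (n, z), Sym.sign _ => if z ∨ n = 2 then none else some (n + 1, false)
  | some (n, z), Sym.endClause => if z ∨ n = 0 then none else some (0, false)

/-- The automaton accepts the string. -/
def Accepts (ys : List Sym) : Prop := ys.foldl syntaxStep (some (0, false)) = some (0, false)

instance (ys : List Sym) : Decidable (Accepts ys) :=
  inferInstanceAs (Decidable (ys.foldl syntaxStep (some (0, false)) = some (0, false)))

/-- The reduction from `2SAT_k`. The digit at the end of the output spoils the codes of formulas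
with too many occurrences of a variable: no code ends with a digit. -/
def reduction (k : ℕ) (ys : List Sym) : List Sym :=
  renamed k ys ++ cycles k ys ++
    if Accepts ys ∧ FewOccurrences k ys then [] else [Sym.bit true]

/-! ## A pointer program for the reduction -/

/-- The pointers of the program: the beginning of the input, the current position of a pass over
the input, the position in the search for later occurrences, and the two positions in the comparison
of digit strings. -/
inductive Ptr
  | start
  | cur
  | scan
  | left
  | right
deriving DecidableEq

instance : Finite Ptr :=
  .of_surjective ![Ptr.start, .cur, .scan, .left, .right] fun i => by
    cases i
    exacts [⟨0, rfl⟩, ⟨1, rfl⟩, ⟨2, rfl⟩, ⟨3, rfl⟩, ⟨4, rfl⟩]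

/-- The memory of the program: the state of the automaton, whether all variables seen so far have
few occurrences, a counter for later occurrences, a digit that is to be compared, and the result of
the comparison if it is known. -/
structure Mem (k : ℕ) where
  syn : Option (Fin 3 × Bool)
  few : Bool
  later : Fin (k + 1)
  digit : Option Bool
  same : Option Bool

instance (k : ℕ) : Finite (Mem k) :=
  .of_injective (fun m => (m.syn, m.few, m.later, m.digit, m.same)) fun m m' h => by
    cases m; cases m'; simpa using h

/-- The memory at the start. -/
def Mem.init (k : ℕ) : Mem k := ⟨some (0, false), true, 0, none, none⟩

/-- The programs for the reduction. -/
abbrev RedProg (k : ℕ) : Type := Prog Sym Sym Ptr (Mem k)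

/-- The states of these programs. -/
abbrev RedSt (k : ℕ) : Type := St Sym Sym Ptr (Mem k)

/-- The part of a state that is left when the scratch pointers and the scratch memory of the
subprograms are disregarded. -/
@[ext]
structure View where
  start : List Sym
  cur : List Sym
  syn : Option (Fin 3 × Bool)
  few : Bool
  later : ℕ
  out : List Sym

/-- The view of a state. -/
def view {k : ℕ} (s : RedSt k) : View :=
  ⟨s.ptr .start, s.ptr .cur, s.mem.syn, s.mem.few, s.mem.later, s.out⟩

/-- On views, the program `p` computes the function `F`. -/
def Computes {k : ℕ} (p : RedProg k) (F : View → View) : Prop :=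
  ∀ s, ∃ t, Exec p s t ∧ view t = F (view s)

/-- The program `p` does nothing but to write the word `w ys`, where `ys` is the remaining input. -/
def Writes {k : ℕ} (p : RedProg k) (w : List Sym → List Sym) : Prop :=
  Computes p fun c => { c with out := c.out ++ w c.cur }

section program

variable {k : ℕ}

theorem Computes.seq {p q : RedProg k} {F G : View → View} (hp : Computes p F)
    (hq : Computes q G) : Computes (.seq p q) fun c => G (F c) := by
  intro s
  obtain ⟨t, hpt, ht⟩ := hp s
  obtain ⟨u, hqu, hu⟩ := hq t
  exact ⟨u, hpt.seq hqu, by rw [hu, ht]⟩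

theorem Writes.seq {p q : RedProg k} {w w' : List Sym → List Sym} (hp : Writes p w)
    (hq : Writes q w') : Writes (.seq p q) fun ys => w ys ++ w' ys := by
  simpa only [Writes, List.append_assoc] using Computes.seq hp hq

/-- Is it a sign? -/
def isSign : Option Sym → Bool
  | some (Sym.sign _) => true
  | _ => false

/-- The digit, if it is one. -/
def bit? : Option Sym → Option Bool
  | some (Sym.bit b) => some b
  | _ => none

theorem bit?_head? (ys : List Sym) : bit? ys.head? = (leadingBits ys).head? := by
  rcases ys with _ | ⟨_ | _ | _, ys⟩ <;> rfl

/-! ### Writing words -/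

/-- The program that does nothing. -/
def skip : RedProg k := .copy .left .left

/-- The program that writes a fixed word. -/
def write : List Sym → RedProg k
  | [] => skip
  | a :: w => .seq (.act .cur fun m _ => (m, false, some a)) (write w)

theorem writes_skip : Writes (skip : RedProg k) fun _ => [] := fun s =>
  ⟨_, .copy .., by simp [view, St.copy]⟩

theorem writes_write (w : List Sym) : Writes (write w : RedProg k) fun _ => w := by
  induction w with
  | nil => exact writes_skip
  | cons a w ih =>
    have hletter : Writes (.act .cur fun m _ => (m, false, some a) : RedProg k) fun _ => [a] :=
      fun s => ⟨_, .act .., rfl⟩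
    exact hletter.seq ih

/-- The program that copies the digits at the current position to the output. -/
def copyDigits : RedProg k :=
  .seq (.copy .left .cur)
    (.loop .left (fun _ a => (bit? a).isSome) (.act .left fun m a => (m, true, a)))

theorem exec_copyDigits_loop (s : RedSt k) :
    ∃ t, Exec (.loop .left (fun _ a => (bit? a).isSome) (.act .left fun m a => (m, true, a))) s t ∧
      view t = { view s with out := s.out ++ (leadingBits (s.ptr .left)).map Sym.bit } := by
  induction hys : s.ptr .left generalizing s with
  | nil => exact ⟨s, .loop_false (by simp [St.test, hys, bit?]), by simp [leadingBits, view]⟩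
  | cons a ys ih =>
    obtain ⟨b, rfl⟩ | hbit : (∃ b, a = Sym.bit b) ∨ bit? (some a) = none := by
      cases a <;> simp [bit?]
    · obtain ⟨t, ht, hview⟩ := ih (s.act .left fun m a => (m, true, a)) (by simp [St.act, hys])
      refine ⟨t, .loop_true (by simp [St.test, hys, bit?]) (.act ..) ht, ?_⟩
      rw [hview]
      simp [view, St.act, hys, leadingBits]
    · have hnil : leadingBits (a :: ys) = [] := by
        rw [← List.head?_eq_none_iff, ← bit?_head?, List.head?_cons, hbit]
      exact ⟨s, .loop_false (by simp [St.test, hys, hbit]), by simp [hnil, view]⟩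

theorem writes_copyDigits :
    Writes (copyDigits : RedProg k) fun ys => (leadingBits ys).map Sym.bit := by
  intro s
  obtain ⟨t, ht, hview⟩ := exec_copyDigits_loop (s.copy .left .cur)
  exact ⟨t, .seq (.copy ..) ht, by simpa [view, St.copy] using hview⟩

/-- The program that writes the clause that says that copy `i` of the variable at the current
position implies copy `j`. -/
def writeImpl (i j : ℕ) : RedProg k :=
  .seq (.seq (write (Sym.sign false :: unary i)) copyDigits)
    (.seq (.seq (write (Sym.sign true :: unary j)) copyDigits) (write [Sym.endClause]))

theorem writes_writeImpl (i j : ℕ) :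
    Writes (writeImpl i j : RedProg k) fun ys => implCode (leadingBits ys) i j :=
  ((writes_write _).seq writes_copyDigits).seq
    (((writes_write _).seq writes_copyDigits).seq (writes_write _))

/-- The program that writes the cycle of implications of the variable at the current position. -/
def writeCycle : RedProg k :=
  (List.range k).foldr (fun t p => .seq (writeImpl t ((t + 1) % k)) p) skip

theorem writes_writeCycle :
    Writes (writeCycle : RedProg k) fun ys => cycleCode k (leadingBits ys) := by
  unfold writeCycle cycleCode
  induction List.range k with
  | nil => exact writes_skip
  | cons t ts ih => exact (writes_writeImpl _ _).seq ih

/-! ### Counting the later occurrences of a variable -/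

/-- The verdict on two digit strings after their first digits, if there are any, have been read. -/
def compareDigits : Option Bool → Option Bool → Option Bool
  | some b, some b' => if b = b' then none else some false
  | none, none => some true
  | _, _ => some false

/-- One step of the comparison of two digit strings. -/
def compareStep : RedProg k :=
  .seq (.act .left fun m a => ({ m with digit := bit? a }, true, none))
    (.act .right fun m a => ({ m with same := compareDigits m.digit (bit? a) }, true, none))

/-- The program that compares the digit strings at the pointers `cur` and `scan`. -/
def compare : RedProg k :=
  .seq (.seq (.copy .left .cur) (.copy .right .scan))
    (.seq (.act .left fun m _ => ({ m with same := none }, false, none))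
      (.loop .left (fun m _ => m.same.isNone) compareStep))

theorem leadingBits_tail {ys : List Sym} {b : Bool} {w : List Bool} (h : leadingBits ys = b :: w) :
    leadingBits ys.tail = w := by
  rcases ys with _ | ⟨_ | _ | _, ys⟩ <;> simp_all [leadingBits]

theorem exec_compareStep (s : RedSt k) : ∃ t, Exec compareStep s t ∧ view t = view s ∧
    t.ptr .scan = s.ptr .scan ∧ t.ptr .left = (s.ptr .left).tail ∧
    t.ptr .right = (s.ptr .right).tail ∧ t.mem.same =
      compareDigits (leadingBits (s.ptr .left)).head? (leadingBits (s.ptr .right)).head? := by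
  refine ⟨_, .seq (.act ..) (.act ..), ?_⟩
  simp [view, St.act, bit?_head?]

theorem exec_compare_loop (s : RedSt k) (hs : s.mem.same = none) :
    ∃ t, Exec (.loop .left (fun m _ => m.same.isNone) compareStep) s t ∧ view t = view s ∧
      t.ptr .scan = s.ptr .scan ∧
      t.mem.same = some (decide (leadingBits (s.ptr .left) = leadingBits (s.ptr .right))) := by
  induction hleft : leadingBits (s.ptr .left) generalizing s with
  | nil =>
    obtain ⟨t, ht, hview, hscan, -, -, hsame⟩ := exec_compareStep s
    refine ⟨t, .loop_true (by simp [St.test, hs]) ht (.loop_false ?_), hview, hscan, ?_⟩ <;>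
      cases hright : leadingBits (s.ptr .right) <;>
      simp [St.test, hsame, hleft, hright, compareDigits]
  | cons b w ih =>
    obtain ⟨t, ht, hview, hscan, htl, htr, hsame⟩ := exec_compareStep s
    by_cases hhead : (leadingBits (s.ptr .right)).head? = some b
    · obtain ⟨w', hright⟩ := List.head?_eq_some_iff.1 hhead
      obtain ⟨u, hu, hview', hscan', hsame'⟩ := ih t
        (by simp [hsame, hleft, hright, compareDigits]) (by rw [htl, leadingBits_tail hleft])
      refine ⟨u, .loop_true (by simp [St.test, hs]) ht hu, hview'.trans hview,
        hscan'.trans hscan, ?_⟩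
      rw [hsame', htr, leadingBits_tail hright, hright]
      simp
    · have hne : compareDigits (some b) (leadingBits (s.ptr .right)).head? = some false := by
        cases hright : leadingBits (s.ptr .right) with
        | nil => rfl
        | cons b' w' => exact if_neg fun h => hhead (by rw [hright, h]; rfl)
      have hdiff : b :: w ≠ leadingBits (s.ptr .right) := fun h => hhead (by rw [← h]; rfl)
      rw [hleft, List.head?_cons, hne] at hsame
      exact ⟨t, .loop_true (by simp [St.test, hs]) ht (.loop_false (by simp [St.test, hsame])),
        hview, hscan, by rw [hsame, decide_eq_false hdiff]⟩

theorem exec_compare (s : RedSt k) : ∃ t, Exec compare s t ∧ view t = view s ∧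
    t.ptr .scan = s.ptr .scan ∧
    t.mem.same = some (decide (leadingBits (s.ptr .cur) = leadingBits (s.ptr .scan))) := by
  obtain ⟨t, ht, hview, hscan, hsame⟩ := exec_compare_loop
    (((s.copy .left .cur).copy .right .scan).act .left fun m _ =>
      ({ m with same := none }, false, none)) rfl
  refine ⟨t, .seq (.seq (.copy ..) (.copy ..)) (.seq (.act ..) ht), ?_⟩
  rw [hview, hscan, hsame]
  simp [view, St.act, St.copy]

/-- Increase the counter, but not beyond `k`. -/
def Mem.countOne (m : Mem k) : Mem k := { m with later := ⟨min k (m.later + 1), by omega⟩ }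

/-- The program that moves the pointer `i` to the next symbol. -/
def advance (i : Ptr) : RedProg k := .act i fun m _ => (m, true, none)

/-- One step of the search for later occurrences. -/
def countStep : RedProg k :=
  .branch .scan (fun _ a => isSign a)
    (.seq (advance .scan) (.seq compare
      (.act .cur fun m _ => (if m.same = some true then m.countOne else m, false, none))))
    (advance .scan)

/-- The program that resets the counter. -/
def resetLater : RedProg k := .act .cur fun m _ => ({ m with later := 0 }, false, none)

theorem computes_resetLater : Computes (resetLater : RedProg k) fun c => { c with later := 0 } :=
  fun s => ⟨_, .act .., by simp [view, St.act]⟩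

/-- The program that counts, up to `k`, the later occurrences of the variable at the current
position. -/
def count : RedProg k :=
  .seq resetLater (.seq (.copy .scan .cur) (.loop .scan (fun _ a => a.isSome) countStep))

theorem exec_countStep_sign (s : RedSt k) {b : Bool} {ys : List Sym}
    (hs : s.ptr .scan = Sym.sign b :: ys) : ∃ t, Exec countStep s t ∧ t.ptr .scan = ys ∧
      view t = { view s with
        later := if leadingBits (s.ptr .cur) = leadingBits ys then min k (s.mem.later + 1)
          else s.mem.later } := by
  obtain ⟨t, ht, hview, hscan, hsame⟩ := exec_compare (s.act .scan fun m _ => (m, true, none))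
  refine ⟨_, .branch_true (by simp [St.test, hs, isSign]) (.seq (.act ..) (.seq ht (.act ..))), ?_⟩
  simp only [view, View.mk.injEq] at hview
  simp only [St.act, hs] at hscan hsame hview
  by_cases h : leadingBits (s.ptr .cur) = leadingBits ys <;>
    simp_all [view, St.act, Mem.countOne]

theorem exec_count_loop (s : RedSt k) :
    ∃ t, Exec (.loop .scan (fun _ a => a.isSome) countStep) s t ∧
      view t = { view s with
        later := min k (s.mem.later +
          ((signTails (s.ptr .scan)).map leadingBits).count (leadingBits (s.ptr .cur))) } := by
  induction hys : s.ptr .scan generalizing s with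
  | nil =>
    refine ⟨s, .loop_false (by simp [St.test, hys]), ?_⟩
    simp [signTails, view, Nat.le_of_lt_succ s.mem.later.2]
  | cons a ys ih =>
    have htest : s.test .scan (fun _ a => a.isSome) = true := by simp [St.test, hys]
    cases a with
    | sign b =>
      obtain ⟨t, ht, hscan, hview⟩ := exec_countStep_sign s hys
      obtain ⟨u, hu, hview'⟩ := ih t hscan
      refine ⟨u, .loop_true htest ht hu, ?_⟩
      rw [hview']
      simp only [view, View.mk.injEq] at hview ⊢
      simp only [hview, signTails, List.map_cons, List.count_cons, beq_iff_eq, true_and,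
        and_true]
      by_cases h : leadingBits (s.ptr .cur) = leadingBits ys
      · simp only [h, if_true]
        omega
      · simp only [h, Ne.symm h, if_false, add_zero]
    | _ =>
      obtain ⟨t, ht, hview⟩ := ih (s.act .scan fun m _ => (m, true, none)) (by simp [St.act, hys])
      refine ⟨t, .loop_true htest (.branch_false (by simp [St.test, hys, isSign]) (.act ..)) ht, ?_⟩
      rw [hview]
      simp [view, St.act, signTails]

theorem computes_count :
    Computes (count : RedProg k) fun c => { c with later := min k (laterCount c.cur) } := by
  intro s
  obtain ⟨t, ht, hview⟩ := exec_count_loop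
    ((s.act .cur fun m _ => ({ m with later := 0 }, false, none)).copy .scan .cur)
  refine ⟨t, .seq (.act ..) (.seq (.copy ..) ht), ?_⟩
  rw [hview]
  simp [view, St.act, St.copy, laterCount]

/-! ### The passes over the input -/

theorem Computes.branch {p q : RedProg k} {F G : View → View} {b : Mem k → Option Sym → Bool}
    {B : View → Bool} (hb : ∀ s : RedSt k, s.test .cur b = B (view s))
    (hp : Computes p F) (hq : Computes q G) :
    Computes (.branch .cur b p q) fun c => if B c then F c else G c := by
  intro s
  cases hB : B (view s)
  · obtain ⟨t, ht, hview⟩ := hq s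
    exact ⟨t, .branch_false ((hb s).trans hB) ht, by simp only [hview, hB, Bool.false_eq_true,
      if_false]⟩
  · obtain ⟨t, ht, hview⟩ := hp s
    exact ⟨t, .branch_true ((hb s).trans hB) ht, by simp only [hview, hB, if_true]⟩

/-- A pass over the rest of the input with the body `p`. -/
def pass (p : RedProg k) : RedProg k := .loop .cur (fun _ a => a.isSome) p

theorem Computes.exec_pass {p : RedProg k} {F : View → View} (hp : Computes p F)
    (hF : ∀ c, (F c).cur = c.cur.tail) (s : RedSt k) :
    ∃ t, Exec (pass p) s t ∧ view t = F^[(s.ptr .cur).length] (view s) := by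
  induction hlen : (s.ptr .cur).length generalizing s with
  | zero => exact ⟨s, .loop_false (by simpa [St.test] using hlen), rfl⟩
  | succ n ih =>
    obtain ⟨t, ht, hview⟩ := hp s
    have hcur : t.ptr .cur = (s.ptr .cur).tail := (congrArg View.cur hview).trans (hF _)
    obtain ⟨u, hu, hview'⟩ := ih t (by rw [hcur, List.length_tail, hlen]; rfl)
    have hne : s.ptr .cur ≠ [] := by rintro h; simp [h] at hlen
    refine ⟨u, .loop_true (by simpa [St.test, List.isSome_head?] using hne) ht hu, ?_⟩
    rw [hview', hview, Function.iterate_succ_apply]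

/-- The program that copies the current symbol to the output, feeds it to the automaton, and
proceeds to the next symbol. -/
def echo : RedProg k :=
  .act .cur fun m a => ({ m with syn := a.elim m.syn (syntaxStep m.syn) }, true, a)

theorem computes_echo : Computes (echo : RedProg k) fun c =>
    { c with
      cur := c.cur.tail
      syn := c.cur.head?.elim c.syn (syntaxStep c.syn)
      out := c.out ++ c.cur.head?.toList } :=
  fun s => ⟨_, .act .., by simp [view, St.act]⟩

theorem computes_advance :
    Computes (advance .cur : RedProg k) fun c => { c with cur := c.cur.tail } :=
  fun s => ⟨_, .act .., by simp [view, St.act]⟩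

/-- The program that records whether the counter has not reached `k`. -/
def recordFew : RedProg k :=
  .act .cur fun m _ => ({ m with few := m.few && decide ((m.later : ℕ) < k) }, false, none)

theorem computes_recordFew : Computes (recordFew : RedProg k) fun c =>
    { c with few := c.few && decide (c.later < k) } :=
  fun s => ⟨_, .act .., by simp [view, St.act]; rfl⟩

/-- The program that writes `unary` of the counter and resets the counter. -/
def writeUnary : RedProg k :=
  .seq (.loop .cur (fun m _ => decide (0 < (m.later : ℕ)))
      (.act .cur fun m _ =>
        ({ m with later := ⟨m.later - 1, by omega⟩ }, false, some (Sym.bit false))))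
    (write [Sym.bit true])

theorem exec_writeUnary_loop (s : RedSt k) :
    ∃ t, Exec (.loop .cur (fun m _ => decide (0 < (m.later : ℕ)))
      (.act .cur fun m _ =>
        ({ m with later := ⟨m.later - 1, by omega⟩ }, false, some (Sym.bit false)))) s t ∧
      view t = { view s with
        later := 0, out := s.out ++ List.replicate s.mem.later (Sym.bit false) } := by
  induction hl : (s.mem.later : ℕ) generalizing s with
  | zero => exact ⟨s, .loop_false (by simp [St.test, hl]), by simp [view, hl]⟩
  | succ l ih =>
    obtain ⟨t, ht, hview⟩ := ih (s.act .cur fun m _ =>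
      ({ m with later := ⟨m.later - 1, by omega⟩ }, false, some (Sym.bit false)))
      (by simp [St.act, hl])
    refine ⟨t, .loop_true (by simp [St.test, hl]) (.act ..) ht, ?_⟩
    rw [hview]
    simp [view, St.act, List.replicate_succ]

theorem computes_writeUnary : Computes (writeUnary : RedProg k) fun c =>
    { c with later := 0, out := c.out ++ unary c.later } := by
  intro s
  obtain ⟨t, ht, hview⟩ := exec_writeUnary_loop s
  obtain ⟨u, hu, hview'⟩ := writes_write [Sym.bit true] t
  exact ⟨u, .seq ht hu, by rw [hview', hview]; simp [view, unary]⟩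

/-- The body of the pass that writes `renamed`. -/
def renameStep : RedProg k :=
  .branch .cur (fun _ a => isSign a) (.seq echo (.seq count (.seq recordFew writeUnary))) echo

/-- What `renameStep` does to views. -/
def View.renameStep (k : ℕ) (c : View) : View :=
  let c' : View := { c with
    cur := c.cur.tail
    syn := c.cur.head?.elim c.syn (syntaxStep c.syn)
    out := c.out ++ c.cur.head?.toList }
  if isSign c.cur.head? then
    { c' with
      few := c'.few && decide (min k (laterCount c'.cur) < k)
      later := 0
      out := c'.out ++ unary (min k (laterCount c'.cur)) }
  else c'

theorem computes_renameStep : Computes (renameStep : RedProg k) (View.renameStep k) :=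
  Computes.branch (fun _ => rfl)
    (computes_echo.seq (computes_count.seq (computes_recordFew.seq computes_writeUnary)))
    computes_echo

theorem decide_fewOccurrences_sign (k : ℕ) (b : Bool) (ys : List Sym) :
    decide (FewOccurrences k (Sym.sign b :: ys)) =
      (decide (laterCount ys < k) && decide (FewOccurrences k ys)) := by
  rw [← Bool.decide_and, decide_eq_decide]
  exact List.forall_mem_cons

theorem View.renameStep_iterate (k : ℕ) (st ys : List Sym) (syn : Option (Fin 3 × Bool))
    (few : Bool) (out : List Sym) :
    (View.renameStep k)^[ys.length] ⟨st, ys, syn, few, 0, out⟩ =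
      ⟨st, [], ys.foldl syntaxStep syn, few && decide (FewOccurrences k ys), 0,
        out ++ renamed k ys⟩ := by
  induction ys generalizing syn few out with
  | nil => simp [FewOccurrences, signTails, renamed]
  | cons a ys ih =>
    rw [List.length_cons, Function.iterate_succ_apply]
    cases a with
    | sign b =>
      rw [decide_fewOccurrences_sign]
      simp [View.renameStep, isSign, ih, renamed, Bool.and_assoc]
    | _ =>
      simp only [View.renameStep, isSign, List.head?_cons, List.tail_cons, Option.elim_some,
        Option.toList_some, Bool.false_eq_true, if_false, ih, renamed, List.append_assoc,
        List.singleton_append]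
      rfl

/-- The body of the pass that writes `cycles`. -/
def cycleStep : RedProg k :=
  .branch .cur (fun _ a => isSign a)
    (.seq (advance .cur) (.seq count
      (.branch .cur (fun m _ => decide ((m.later : ℕ) = 0)) writeCycle resetLater)))
    (advance .cur)

/-- What `cycleStep` does to views. -/
def View.cycleStep (k : ℕ) (c : View) : View :=
  let c' : View := { c with cur := c.cur.tail }
  let l := min k (laterCount c'.cur)
  if isSign c.cur.head? then
    if decide (l = 0) then
      { c' with later := l, out := c'.out ++ cycleCode k (leadingBits c'.cur) }
    else { c' with later := 0 }
  else c'

theorem computes_cycleStep : Computes (cycleStep : RedProg k) (View.cycleStep k) :=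
  Computes.branch (fun _ => rfl)
    (computes_advance.seq (computes_count.seq (Computes.branch (B := fun c => decide (c.later = 0))
      (fun _ => rfl) writes_writeCycle computes_resetLater)))
    computes_advance

theorem View.cycleStep_iterate (k : ℕ) (st ys : List Sym) (syn : Option (Fin 3 × Bool))
    (few : Bool) (out : List Sym) :
    (View.cycleStep k)^[ys.length] ⟨st, ys, syn, few, 0, out⟩ =
      ⟨st, [], syn, few, 0, out ++ cycles k ys⟩ := by
  induction ys generalizing out with
  | nil => simp [cycles, signTails]
  | cons a ys ih =>
    rw [List.length_cons, Function.iterate_succ_apply]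
    cases a with
    | sign b =>
      obtain rfl | hk := Nat.eq_zero_or_pos k
      · simp [View.cycleStep, isSign, ih, cycles, signTails, cycleCode]
      · by_cases hl : laterCount ys = 0 <;>
          simp [View.cycleStep, isSign, ih, cycles, signTails, hl, hk.ne']
    | _ => simp [View.cycleStep, isSign, ih, cycles, signTails]

/-- The program that computes the reduction. -/
def reductionProg (k : ℕ) : RedProg k :=
  .seq (pass renameStep) (.seq (.copy .cur .start) (.seq (pass cycleStep)
    (.branch .cur (fun m _ => decide (m.syn = some (0, false)) && m.few) skip
      (write [Sym.bit true]))))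

theorem exec_reductionProg (k : ℕ) (x : List Sym) :
    ∃ t, Exec (reductionProg k) ⟨Mem.init k, fun _ => x, []⟩ t ∧ t.out = reduction k x := by
  obtain ⟨s, hs, hrename⟩ := computes_renameStep.exec_pass
    (fun c => by simp only [View.renameStep]; split_ifs <;> rfl)
    (⟨Mem.init k, fun _ => x, []⟩ : RedSt k)
  obtain ⟨t, ht, hcycle⟩ := computes_cycleStep.exec_pass
    (fun c => by simp only [View.cycleStep]; split_ifs <;> rfl) (s.copy .cur .start)
  have hfinish : Computes (.branch .cur (fun m _ => decide (m.syn = some (0, false)) && m.few) skip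
      (write [Sym.bit true]) : RedProg k) _ :=
    Computes.branch (B := fun c => decide (c.syn = some (0, false)) && c.few) (fun _ => rfl)
      writes_skip (writes_write [Sym.bit true])
  obtain ⟨u, hu, hviewu⟩ := hfinish t
  refine ⟨u, .seq hs (.seq (.copy ..) (.seq ht hu)), ?_⟩
  have hviews : view s = ⟨x, [], x.foldl syntaxStep (some (0, false)),
      decide (FewOccurrences k x), 0, renamed k x⟩ :=
    hrename.trans (View.renameStep_iterate ..)
  have hviewt : view t = ⟨x, [], x.foldl syntaxStep (some (0, false)),
      decide (FewOccurrences k x), 0, renamed k x ++ cycles k x⟩ := by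
    simp only [view, View.mk.injEq] at hviews
    rw [hcycle, ← View.cycleStep_iterate]
    simp [view, St.copy, hviews]
  have hout := congrArg View.out hviewu
  rw [hviewt] at hout
  refine hout.trans ?_
  by_cases h : Accepts x ∧ FewOccurrences k x
  · rw [if_pos (by simpa [Accepts] using h), reduction, if_pos h]
  · rw [if_neg (by simpa [Accepts] using h), reduction, if_neg h]

end program

/-! ### Lengths -/

theorem length_leadingBits_le (ys : List Sym) : (leadingBits ys).length ≤ ys.length := by
  fun_induction leadingBits ys with
  | case1 b ys ih => simpa using ih
  | case2 => simp

theorem length_signTails_le (ys : List Sym) : (signTails ys).length ≤ ys.length := by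
  fun_induction signTails ys <;> grind

theorem length_le_of_mem_signTails {ys zs : List Sym} (h : zs ∈ signTails ys) :
    zs.length ≤ ys.length := by
  fun_induction signTails ys <;> grind

theorem length_renamed_le (k : ℕ) (ys : List Sym) :
    (renamed k ys).length ≤ (k + 2) * ys.length := by
  fun_induction renamed k ys <;> simp [unary, Nat.mul_succ] <;> omega

theorem length_cycleCode_le (k : ℕ) (w : List Bool) :
    (cycleCode k w).length ≤ k * (2 * k + 2 * w.length + 5) := by
  rw [cycleCode, List.length_flatMap]
  refine (List.sum_le_card_nsmul _ (2 * k + 2 * w.length + 5) ?_).trans_eq (by simp)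
  simp only [List.mem_map, List.mem_range]
  rintro _ ⟨t, ht, rfl⟩
  have hmod : (t + 1) % k < k := Nat.mod_lt _ (by omega)
  simp [implCode, unary]
  omega

theorem length_cycles_le (k : ℕ) (ys : List Sym) :
    (cycles k ys).length ≤ ys.length * (k * (2 * k + 2 * ys.length + 5)) := by
  rw [cycles, List.length_flatMap]
  refine (List.sum_le_card_nsmul _ (k * (2 * k + 2 * ys.length + 5)) ?_).trans ?_
  · simp only [List.mem_map]
    rintro _ ⟨zs, hzs, rfl⟩
    have hlen := (length_leadingBits_le zs).trans (length_le_of_mem_signTails hzs)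
    split_ifs
    · exact (length_cycleCode_le ..).trans (by gcongr)
    · simp
  · rw [List.length_map, smul_eq_mul]
    gcongr
    exact length_signTails_le ys

theorem exists_poly_le_pow_add (C d : ℕ) : ∃ e : ℕ, ∀ n, C * (n + 2) ^ d ≤ n ^ e + e := by
  refine ⟨2 * d + C + C * 3 ^ d, fun n => ?_⟩
  obtain hn | hn := Nat.lt_or_ge n 2
  · have hpow : C * (n + 2) ^ d ≤ C * 3 ^ d := by gcongr; omega
    omega
  · have hsq : n + 2 ≤ n ^ 2 := by nlinarith
    calc C * (n + 2) ^ d ≤ n ^ C * (n ^ 2) ^ d := by gcongr; exact (Nat.lt_pow_self hn).le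
      _ = n ^ (2 * d + C) := by ring
      _ ≤ n ^ (2 * d + C + C * 3 ^ d) := Nat.pow_le_pow_right (by omega) (by omega)
      _ ≤ _ := Nat.le_add_right _ _

theorem exists_length_reduction_le (k : ℕ) :
    ∃ e : ℕ, ∀ ys, (reduction k ys).length ≤ ys.length ^ e + e := by
  obtain ⟨e, he⟩ := exists_poly_le_pow_add (2 * k ^ 2 + 8 * k + 2) 2
  refine ⟨e, fun ys => le_trans ?_ (he ys.length)⟩
  have hrenamed := length_renamed_le k ys
  have hcycles := length_cycles_le k ys
  have hend : (if Accepts ys ∧ FewOccurrences k ys then [] else [Sym.bit true]).length ≤ 1 := by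
    split_ifs <;> simp
  rw [reduction, List.length_append, List.length_append]
  generalize ys.length = n at *
  have hpoly : (2 * k ^ 2 + 8 * k + 2) * (n + 2) ^ 2 = (k + 2) * n +
      n * (k * (2 * k + 2 * n + 5)) + 1 +
      (2 * k ^ 2 * n ^ 2 + 6 * k ^ 2 * n + 8 * k ^ 2 + 6 * k * n ^ 2 + 26 * k * n + 32 * k +
        2 * n ^ 2 + 6 * n + 7) := by ring
  omega

theorem fl_reduction (k : ℕ) : FL (reduction k) :=
  Prog.fl_of_exec (reductionProg k) (Mem.init k) (reduction k) (exists_length_reduction_le k)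
    (exec_reductionProg k)

/-! ## The codes of formulas -/

/-- Every clause has one or two literals: the formulas whose codes the automaton accepts. Unlike
`IsTwoCNF`, the condition excludes the empty clause. -/
def OneOrTwo (φ : CNF) : Prop := ∀ c ∈ φ, c ≠ [] ∧ c.length ≤ 2

theorem oneOrTwo_cons {c : Clause} {φ : CNF} :
    OneOrTwo (c :: φ) ↔ (c ≠ [] ∧ c.length ≤ 2) ∧ OneOrTwo φ :=
  List.forall_mem_cons

theorem Satisfiable.nil_notMem {φ : CNF} (h : Satisfiable φ) : [] ∉ φ := by
  obtain ⟨σ, hσ⟩ := h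
  intro hnil
  obtain ⟨l, hl, -⟩ := hσ [] hnil
  exact List.not_mem_nil hl

theorem IsTwoCNF.oneOrTwo {φ : CNF} (h : IsTwoCNF φ) (hsat : Satisfiable φ) : OneOrTwo φ :=
  fun c hc => ⟨fun hnil => hsat.nil_notMem (hnil ▸ hc), h c hc⟩

theorem encode_cons (c : Clause) (φ : CNF) :
    encode (c :: φ) = c.flatMap encodeLiteral ++ Sym.endClause :: encode φ := by
  simp [encode, encodeClause]

theorem encode_append (φ ψ : CNF) : encode (φ ++ ψ) = encode φ ++ encode ψ := by
  simp [encode]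

theorem encode_ne_append_bit (φ : CNF) (ys : List Sym) (b : Bool) :
    encode φ ≠ ys ++ [Sym.bit b] := by
  intro h
  obtain rfl | ⟨φ', c, rfl⟩ := List.eq_nil_or_concat φ
  · simp [encode] at h
  · rw [List.concat_eq_append, encode_append, encode_cons] at h
    simpa [encode] using congrArg List.getLast? h

theorem bits_injective : Function.Injective Nat.bits :=
  Function.LeftInverse.injective foldr_bit_bits

/-! ## Recognizing the codes of formulas -/

theorem foldl_syntaxStep_none (ys : List Sym) : ys.foldl syntaxStep none = none := by
  induction ys with
  | nil => rfl
  | cons a ys ih => cases a <;> exact ih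

theorem foldl_syntaxStep_bits {n : Fin 3} (hn : n ≠ 0) (v : ℕ) (z : Bool) :
    (v.bits.map Sym.bit).foldl syntaxStep (some (n, z)) =
      some (n, if v = 0 then z else false) := by
  induction v using Nat.binaryRec' generalizing z with
  | zero => simp
  | bit b m h ih =>
    have hne : Nat.bit b m ≠ 0 := Nat.bit_ne_zero_iff.2 h
    rw [Nat.bits_append_bit m b h, List.map_cons, List.foldl_cons]
    simp only [syntaxStep, hn, if_false, ih, hne]
    obtain rfl | hm := eq_or_ne m 0
    · simp [h rfl]
    · simp [hm]

theorem foldl_syntaxStep_literal {n : Fin 3} (hn : n ≠ 2) (l : Literal) :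
    (encodeLiteral l).foldl syntaxStep (some (n, false)) = some (n + 1, false) := by
  have hsucc : n + 1 ≠ 0 := by fin_cases n <;> simp_all
  rw [encodeLiteral, List.foldl_cons]
  simp only [syntaxStep, hn, Bool.false_eq_true, or_self, if_false]
  rw [foldl_syntaxStep_bits hsucc, ite_self]

theorem accepts_encode {φ : CNF} (h : OneOrTwo φ) : Accepts (encode φ) := by
  induction φ with
  | nil => rfl
  | cons c φ ih =>
    obtain ⟨⟨hne, hlen⟩, hφ⟩ := oneOrTwo_cons.1 h
    rw [encode_cons, Accepts, List.foldl_append, List.foldl_cons]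
    match c with
    | [] => exact absurd rfl hne
    | [l] => simpa [foldl_syntaxStep_literal, syntaxStep, Accepts] using ih hφ
    | [l, l'] => simpa [foldl_syntaxStep_literal, syntaxStep, Accepts] using ih hφ
    | _ :: _ :: _ :: _ => simp at hlen

/-- The string completes the code of a formula, from a position within the digits of a literal:
`n` is the number of literals begun in the current clause, and `z` says that the last digit was
zero, so that another digit has to follow. -/
def CompletesLiteral (n : ℕ) (z : Bool) (ys : List Sym) : Prop :=
  ∃ (v : ℕ) (c : Clause) (φ : CNF), (z = true → v ≠ 0) ∧ n + c.length ≤ 2 ∧ OneOrTwo φ ∧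
    ys = v.bits.map Sym.bit ++ encode (c :: φ)

theorem CompletesLiteral.bit {n : ℕ} {b z : Bool} {ys : List Sym}
    (h : CompletesLiteral n (!b) ys) : CompletesLiteral n z (Sym.bit b :: ys) := by
  obtain ⟨v, c, φ, hv, hlen, hφ, rfl⟩ := h
  have hb : v = 0 → b = true := by cases b <;> simp_all
  exact ⟨Nat.bit b v, c, φ, fun _ => Nat.bit_ne_zero_iff.2 hb, hlen, hφ,
    by simp [Nat.bits_append_bit v b hb]⟩

theorem CompletesLiteral.sign {n : ℕ} {s : Bool} {ys : List Sym}
    (h : CompletesLiteral (n + 1) false ys) : CompletesLiteral n false (Sym.sign s :: ys) := by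
  obtain ⟨v, c, φ, -, hlen, hφ, rfl⟩ := h
  exact ⟨0, ⟨v, s⟩ :: c, φ, by simp, by rw [List.length_cons]; omega, hφ,
    by simp [encode_cons, encodeLiteral]⟩

theorem completesLiteral_endClause {n : ℕ} (hn : n ≤ 2) {φ : CNF} (hφ : OneOrTwo φ) :
    CompletesLiteral n false (Sym.endClause :: encode φ) :=
  ⟨0, [], φ, by simp, hn, hφ, by simp [encode_cons]⟩

theorem CompletesLiteral.exists_encode {s : Bool} {ys : List Sym}
    (h : CompletesLiteral 1 false ys) : ∃ φ, OneOrTwo φ ∧ encode φ = Sym.sign s :: ys := by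
  obtain ⟨v, c, φ, -, hlen, hφ, rfl⟩ := h
  refine ⟨(⟨v, s⟩ :: c) :: φ, oneOrTwo_cons.2 ⟨⟨List.cons_ne_nil _ _, ?_⟩, hφ⟩,
    by simp [encode_cons, encodeLiteral]⟩
  rw [List.length_cons]
  omega

theorem completes_of_foldl_syntaxStep {n : Fin 3} {z : Bool} {ys : List Sym}
    (h : ys.foldl syntaxStep (some (n, z)) = some (0, false)) :
    (n = 0 → ∃ φ, OneOrTwo φ ∧ encode φ = ys) ∧ (n ≠ 0 → CompletesLiteral n z ys) := by
  induction ys generalizing n z with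
  | nil =>
    obtain ⟨rfl, -⟩ : n = 0 ∧ z = false := by simpa using h
    exact ⟨fun _ => ⟨[], by simp [OneOrTwo], rfl⟩, fun hn => absurd rfl hn⟩
  | cons a ys ih =>
    rw [List.foldl_cons] at h
    cases a with
    | bit b =>
      rw [syntaxStep] at h
      split_ifs at h with hn
      · simp [foldl_syntaxStep_none] at h
      · exact ⟨fun h₀ => absurd h₀ hn, fun hn => ((ih h).2 hn).bit⟩
    | sign s =>
      rw [syntaxStep] at h
      split_ifs at h with hdead
      · simp [foldl_syntaxStep_none] at h
      · obtain ⟨hz, hn⟩ := not_or.1 hdead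
        obtain rfl := Bool.eq_false_iff.2 hz
        have hval : ((n + 1 : Fin 3) : ℕ) = n + 1 := by fin_cases n <;> simp_all
        have htail := (ih h).2 (by fin_cases n <;> simp_all)
        rw [hval] at htail
        exact ⟨fun h₀ => by subst h₀; exact htail.exists_encode, fun _ => htail.sign⟩
    | endClause =>
      rw [syntaxStep] at h
      split_ifs at h with hdead
      · simp [foldl_syntaxStep_none] at h
      · obtain ⟨hz, hn⟩ := not_or.1 hdead
        obtain rfl := Bool.eq_false_iff.2 hz
        obtain ⟨φ, hφ, rfl⟩ := (ih h).1 rfl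
        exact ⟨fun h₀ => absurd h₀ hn,
          fun _ => completesLiteral_endClause (Nat.le_of_lt_succ n.isLt) hφ⟩

theorem Accepts.exists_encode {ys : List Sym} (h : Accepts ys) :
    ∃ φ, OneOrTwo φ ∧ encode φ = ys :=
  (completes_of_foldl_syntaxStep h).1 rfl

/-! ## The occurrences of variables in a code -/

/-- The variables of a list of literals, with repetitions. -/
def varsOf (ls : List Literal) : List ℕ := ls.map Literal.var

theorem varsOf_append (ls ms : List Literal) : varsOf (ls ++ ms) = varsOf ls ++ varsOf ms :=
  List.map_append

theorem leadingBits_bits_append (bs : List Bool) {ys : List Sym} (h : leadingBits ys = []) :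
    leadingBits (bs.map Sym.bit ++ ys) = bs := by
  induction bs with
  | nil => exact h
  | cons b bs ih => simp [leadingBits, ih]

theorem leadingBits_clause (c : Clause) (ys : List Sym) :
    leadingBits (c.flatMap encodeLiteral ++ Sym.endClause :: ys) = [] := by
  cases c <;> simp [leadingBits, encodeLiteral]

theorem signTails_bits_append (bs : List Bool) (ys : List Sym) :
    signTails (bs.map Sym.bit ++ ys) = signTails ys := by
  induction bs with
  | nil => rfl
  | cons b bs ih => simpa [signTails] using ih

theorem map_leadingBits_signTails_clause (c : Clause) (ys : List Sym) :
    (signTails (c.flatMap encodeLiteral ++ Sym.endClause :: ys)).map leadingBits =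
      (varsOf c).map Nat.bits ++ (signTails ys).map leadingBits := by
  induction c with
  | nil => rfl
  | cons l c ih =>
    simp only [List.flatMap_cons, encodeLiteral, List.cons_append, List.append_assoc, signTails,
      signTails_bits_append, List.map_cons, ih, varsOf,
      leadingBits_bits_append _ (leadingBits_clause c ys)]

theorem map_leadingBits_signTails_encode (φ : CNF) :
    (signTails (encode φ)).map leadingBits = (varsOf φ.flatten).map Nat.bits := by
  induction φ with
  | nil => rfl
  | cons c φ ih =>
    rw [encode_cons, map_leadingBits_signTails_clause, ih, List.flatten_cons, varsOf_append,
      List.map_append]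

theorem laterCount_clause (v : ℕ) (c : Clause) (φ : CNF) :
    laterCount (v.bits.map Sym.bit ++ (c.flatMap encodeLiteral ++ Sym.endClause :: encode φ)) =
      (varsOf (c ++ φ.flatten)).count v := by
  rw [laterCount, leadingBits_bits_append _ (leadingBits_clause c _), signTails_bits_append,
    map_leadingBits_signTails_clause, map_leadingBits_signTails_encode, ← List.map_append,
    List.count_map_of_injective _ _ bits_injective, varsOf_append]

theorem fewOccurrences_cons_sign {k : ℕ} {s : Bool} {ys : List Sym} :
    FewOccurrences k (Sym.sign s :: ys) ↔ laterCount ys < k ∧ FewOccurrences k ys :=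
  List.forall_mem_cons

theorem fewOccurrences_iff_count_le (k : ℕ) (ys : List Sym) :
    FewOccurrences k ys ↔ ∀ w, ((signTails ys).map leadingBits).count w ≤ k := by
  induction ys with
  | nil => simp [FewOccurrences, signTails]
  | cons a ys ih =>
    cases a with
    | bit b => exact ih
    | endClause => exact ih
    | sign s =>
      rw [fewOccurrences_cons_sign, ih, signTails, List.map_cons, laterCount]
      refine ⟨fun ⟨hlt, hle⟩ w => ?_, fun h => ⟨?_, fun w => ?_⟩⟩
      · obtain rfl | hw := eq_or_ne w (leadingBits ys)
        · rw [List.count_cons_self]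
          exact hlt
        · rw [List.count_cons_of_ne hw.symm]
          exact hle w
      · have hhead := h (leadingBits ys)
        rwa [List.count_cons_self] at hhead
      · exact List.count_le_count_cons.trans (h w)

theorem fewOccurrences_encode (k : ℕ) (φ : CNF) :
    FewOccurrences k (encode φ) ↔ ∀ v, occurrences φ v ≤ k := by
  have hcount (v : ℕ) : ((varsOf φ.flatten).map Nat.bits).count v.bits = occurrences φ v :=
    List.count_map_of_injective _ _ bits_injective v
  rw [fewOccurrences_iff_count_le, map_leadingBits_signTails_encode]
  refine ⟨fun h v => hcount v ▸ h v.bits, fun h w => ?_⟩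
  by_cases hw : w ∈ (varsOf φ.flatten).map Nat.bits
  · obtain ⟨v, -, rfl⟩ := List.mem_map.1 hw
    exact (hcount v).trans_le (h v)
  · rw [List.count_eq_zero_of_not_mem hw]
    exact Nat.zero_le k

/-! ## The reduction on formulas -/

/-- Copy `j` of the variable `v`. Its digits are `j` zeros, a one, and the digits of `v`. -/
def copyVar (j v : ℕ) : ℕ := 2 ^ j * (2 * v + 1)

theorem copyVar_zero (v : ℕ) : copyVar 0 v = Nat.bit true v := by
  simp [copyVar, Nat.bit]

theorem copyVar_succ (j v : ℕ) : copyVar (j + 1) v = Nat.bit false (copyVar j v) := by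
  simp only [copyVar, Nat.bit, pow_succ, cond_false]
  ring

theorem copyVar_ne_zero (j v : ℕ) : copyVar j v ≠ 0 := by
  simp [copyVar]

theorem bits_copyVar (j v : ℕ) :
    (copyVar j v).bits = List.replicate j false ++ true :: v.bits := by
  induction j with
  | zero => simp [copyVar_zero]
  | succ j ih =>
    rw [copyVar_succ, Nat.bits_append_bit _ _ fun h => absurd h (copyVar_ne_zero j v), ih,
      List.replicate_succ, List.cons_append]

theorem map_bits_copyVar (j v : ℕ) :
    (copyVar j v).bits.map Sym.bit = unary j ++ v.bits.map Sym.bit := by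
  simp [bits_copyVar, unary]

theorem copyVar_inj {i j v w : ℕ} (h : copyVar i v = copyVar j w) : i = j ∧ v = w := by
  induction i generalizing j with
  | zero =>
    cases j <;> simp only [copyVar_zero, copyVar_succ, Nat.bit_false, Nat.bit_true] at h <;> omega
  | succ i ih =>
    cases j with
    | zero =>
      simp only [copyVar_zero, copyVar_succ, Nat.bit_false, Nat.bit_true] at h
      omega
    | succ j =>
      simp only [copyVar_succ, Nat.bit_false] at h
      obtain ⟨rfl, rfl⟩ := ih (j := j) (by omega)
      exact ⟨rfl, rfl⟩

/-- The clause with its variables replaced by copies; `rest` are the literals that follow the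
clause in the formula. -/
def renameClause (k : ℕ) (rest : List Literal) : Clause → Clause
  | [] => []
  | l :: c => ⟨copyVar (min k ((varsOf (c ++ rest)).count l.var)) l.var, l.pos⟩ ::
      renameClause k rest c

/-- The formula with every occurrence of a variable replaced by a copy. The number of the copy is
the number of later occurrences, but at most `k`. -/
def renameCNF (k : ℕ) : CNF → CNF
  | [] => []
  | c :: φ => renameClause k φ.flatten c :: renameCNF k φ

/-- The clause that says that, for `p = (v, t)`, copy `t` of the variable `v` implies the cyclically
next of the `k` copies. -/
def implClause (k : ℕ) (p : ℕ × ℕ) : Clause :=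
  [⟨copyVar p.2 p.1, false⟩, ⟨copyVar ((p.2 + 1) % k) p.1, true⟩]

/-- For each of the variables, the clauses that say that its `k` copies are equivalent. -/
def cyclesCNF (k : ℕ) (vs : List ℕ) : CNF :=
  (vs.dedup ×ˢ List.range k).map (implClause k)

/-- The formula whose code is the value of the reduction at the code of `φ`. -/
def reduceCNF (k : ℕ) (φ : CNF) : CNF := renameCNF k φ ++ cyclesCNF k (varsOf φ.flatten)

theorem renamed_bits_append (k : ℕ) (bs : List Bool) (ys : List Sym) :
    renamed k (bs.map Sym.bit ++ ys) = bs.map Sym.bit ++ renamed k ys := by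
  induction bs with
  | nil => rfl
  | cons b bs ih => simpa [renamed] using ih

theorem renamed_clause (k : ℕ) (c : Clause) (φ : CNF) :
    renamed k (c.flatMap encodeLiteral ++ Sym.endClause :: encode φ) =
      (renameClause k φ.flatten c).flatMap encodeLiteral ++
        Sym.endClause :: renamed k (encode φ) := by
  induction c with
  | nil => rfl
  | cons l c ih =>
    simp only [List.flatMap_cons, encodeLiteral, List.cons_append, List.append_assoc, renamed,
      renamed_bits_append, ih, renameClause, map_bits_copyVar, laterCount_clause]

theorem renamed_encode (k : ℕ) (φ : CNF) : renamed k (encode φ) = encode (renameCNF k φ) := by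
  induction φ with
  | nil => rfl
  | cons c φ ih => rw [encode_cons, renamed_clause, ih, renameCNF, encode_cons]

theorem encode_cyclesCNF_cons (k v : ℕ) (vs : List ℕ) :
    encode (cyclesCNF k (v :: vs)) =
      (if vs.count v = 0 then cycleCode k v.bits else []) ++ encode (cyclesCNF k vs) := by
  rw [cyclesCNF, cyclesCNF]
  simp only [List.count_eq_zero]
  split_ifs with hv
  · rw [List.dedup_cons_of_mem hv, List.nil_append]
  · rw [List.dedup_cons_of_notMem hv, List.product_cons, List.map_append, encode_append]
    congr 1
    simp [encode, cycleCode, List.flatMap_map, encodeClause, implClause, implCode,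
      encodeLiteral, map_bits_copyVar]

theorem cycles_clause (k : ℕ) (c : Clause) (φ : CNF)
    (h : cycles k (encode φ) = encode (cyclesCNF k (varsOf φ.flatten))) :
    cycles k (c.flatMap encodeLiteral ++ Sym.endClause :: encode φ) =
      encode (cyclesCNF k (varsOf (c ++ φ.flatten))) := by
  induction c with
  | nil => exact h
  | cons l c ih =>
    rw [List.cons_append, varsOf, List.map_cons, ← varsOf, encode_cyclesCNF_cons, ← ih]
    simp only [List.flatMap_cons, encodeLiteral, List.cons_append, List.append_assoc, cycles,
      signTails, signTails_bits_append, laterCount_clause,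
      leadingBits_bits_append _ (leadingBits_clause c _)]

theorem cycles_encode (k : ℕ) (φ : CNF) :
    cycles k (encode φ) = encode (cyclesCNF k (varsOf φ.flatten)) := by
  induction φ with
  | nil => rfl
  | cons c φ ih => rw [encode_cons, cycles_clause k c φ ih, List.flatten_cons]

theorem reduction_encode {k : ℕ} {φ : CNF} (h : OneOrTwo φ) (hk : ∀ v, occurrences φ v ≤ k) :
    reduction k (encode φ) = encode (reduceCNF k φ) := by
  rw [reduction, if_pos ⟨accepts_encode h, (fewOccurrences_encode k φ).2 hk⟩, List.append_nil,
    renamed_encode, cycles_encode, reduceCNF, encode_append]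

theorem encode_ne_reduction {k : ℕ} {ys : List Sym}
    (h : ∀ φ, OneOrTwo φ → (∀ v, occurrences φ v ≤ k) → encode φ ≠ ys) (ψ : CNF) :
    encode ψ ≠ reduction k ys := by
  have hbad : ¬ (Accepts ys ∧ FewOccurrences k ys) := by
    rintro ⟨hacc, hfew⟩
    obtain ⟨φ, hφ, rfl⟩ := hacc.exists_encode
    exact h φ hφ ((fewOccurrences_encode k φ).1 hfew) rfl
  rw [reduction, if_neg hbad]
  exact encode_ne_append_bit _ _ _

/-! ## The variables of the reduced formula -/

/-- The variables of the renamed formula, as a function of the variables of the formula. -/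
def renameVars (k : ℕ) : List ℕ → List ℕ
  | [] => []
  | v :: vs => copyVar (min k (vs.count v)) v :: renameVars k vs

theorem varsOf_renameClause_append (k : ℕ) (c : Clause) (rest : List Literal) :
    varsOf (renameClause k rest c) ++ renameVars k (varsOf rest) =
      renameVars k (varsOf (c ++ rest)) := by
  induction c with
  | nil => rfl
  | cons l c ih => simpa [renameClause, varsOf, renameVars] using ih

theorem varsOf_renameCNF (k : ℕ) (φ : CNF) :
    varsOf (renameCNF k φ).flatten = renameVars k (varsOf φ.flatten) := by
  induction φ with
  | nil => rfl
  | cons c φ ih =>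
    rw [renameCNF, List.flatten_cons, varsOf_append, ih, varsOf_renameClause_append,
      List.flatten_cons]

theorem exists_of_mem_renameVars {k u : ℕ} {vs : List ℕ} (h : u ∈ renameVars k vs) :
    ∃ j v, v ∈ vs ∧ j < vs.count v ∧ u = copyVar j v := by
  induction vs with
  | nil => cases h
  | cons w vs ih =>
    obtain rfl | h := List.mem_cons.1 h
    · refine ⟨_, w, List.mem_cons_self, ?_, rfl⟩
      rw [List.count_cons_self]
      omega
    · obtain ⟨j, v, hv, hj, hu⟩ := ih h
      exact ⟨j, v, List.mem_cons_of_mem _ hv, hj.trans_le List.count_le_count_cons, hu⟩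

theorem nodup_renameVars {k : ℕ} {vs : List ℕ} (h : ∀ v, vs.count v ≤ k) :
    (renameVars k vs).Nodup := by
  induction vs with
  | nil => exact List.nodup_nil
  | cons w vs ih =>
    refine List.nodup_cons.2 ⟨fun hmem => ?_, ih fun v => List.count_le_count_cons.trans (h v)⟩
    obtain ⟨j, v, -, hj, hcopy⟩ := exists_of_mem_renameVars hmem
    obtain ⟨hmin, rfl⟩ := copyVar_inj hcopy
    have hw := h w
    rw [List.count_cons_self] at hw
    omega

theorem exists_of_mem_varsOf_cyclesCNF {k u : ℕ} {vs : List ℕ}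
    (h : u ∈ varsOf (cyclesCNF k vs).flatten) : ∃ j v, v ∈ vs ∧ j < k ∧ u = copyVar j v := by
  obtain ⟨l, hl, rfl⟩ := List.mem_map.1 h
  obtain ⟨c, hc, hlc⟩ := List.mem_flatten.1 hl
  obtain ⟨⟨v, t⟩, hp, rfl⟩ := List.mem_map.1 hc
  simp only [List.mem_product, List.mem_dedup, List.mem_range] at hp
  simp only [implClause, List.mem_cons, List.not_mem_nil, or_false] at hlc
  obtain rfl | rfl := hlc
  · exact ⟨t, v, hp.1, hp.2, rfl⟩
  · exact ⟨(t + 1) % k, v, hp.1, Nat.mod_lt _ (by omega), rfl⟩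

theorem count_varsOf_map_implClause (k : ℕ) (ps : List (ℕ × ℕ)) (u : ℕ) :
    (varsOf (ps.map (implClause k)).flatten).count u =
      (ps.map fun p => copyVar p.2 p.1).count u +
        (ps.map fun p => copyVar ((p.2 + 1) % k) p.1).count u := by
  induction ps with
  | nil => rfl
  | cons p ps ih =>
    simp only [List.map_cons, List.flatten_cons, varsOf_append, List.count_append, ih]
    simp only [varsOf, implClause, List.map_cons, List.map_nil, List.count_cons, List.count_nil]
    omega

theorem succ_mod_injOn (k : ℕ) : Set.InjOn (fun t => (t + 1) % k) (Set.Iio k) :=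
  fun _ hi _ hj h => (Nat.ModEq.add_right_cancel' 1 h).eq_of_lt_of_lt hi hj

theorem nodup_map_copyVar {k : ℕ} {vs : List ℕ} (hvs : vs.Nodup) {e : ℕ → ℕ}
    (he : Set.InjOn e (Set.Iio k)) :
    ((vs ×ˢ List.range k).map fun p => copyVar (e p.2) p.1).Nodup := by
  refine (hvs.product List.nodup_range).map_on ?_
  rintro ⟨v, i⟩ hi ⟨w, j⟩ hj h
  simp only [List.mem_product, List.mem_range] at hi hj
  obtain ⟨hij, rfl⟩ := copyVar_inj h
  rw [he hi.2 hj.2 hij]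

/-- Every copy of a variable is the source of one implication and the target of one. -/
theorem count_varsOf_cyclesCNF_le (k : ℕ) (vs : List ℕ) (u : ℕ) :
    (varsOf (cyclesCNF k vs).flatten).count u ≤ 2 := by
  rw [cyclesCNF, count_varsOf_map_implClause]
  exact add_le_add
    (List.nodup_iff_count_le_one.1 (nodup_map_copyVar vs.nodup_dedup (Set.injOn_id _)) u)
    (List.nodup_iff_count_le_one.1 (nodup_map_copyVar vs.nodup_dedup (succ_mod_injOn k)) u)

theorem occurrences_reduceCNF_le {k : ℕ} {φ : CNF} (hk : ∀ v, occurrences φ v ≤ k) (u : ℕ) :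
    occurrences (reduceCNF k φ) u ≤ 3 := by
  have hrename : (varsOf (renameCNF k φ).flatten).count u ≤ 1 := by
    rw [varsOf_renameCNF]
    exact List.nodup_iff_count_le_one.1 (nodup_renameVars hk) u
  calc occurrences (reduceCNF k φ) u
      = (varsOf (renameCNF k φ).flatten).count u +
          (varsOf (cyclesCNF k (varsOf φ.flatten)).flatten).count u := by
        rw [occurrences, ← varsOf, reduceCNF, List.flatten_append, varsOf_append,
          List.count_append]
    _ ≤ 1 + 2 := add_le_add hrename (count_varsOf_cyclesCNF_le ..)

/-! ## Satisfiability of the reduced formula -/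

theorem length_renameClause (k : ℕ) (rest : List Literal) (c : Clause) :
    (renameClause k rest c).length = c.length := by
  induction c with
  | nil => rfl
  | cons l c ih => simp [renameClause, ih]

theorem length_renameCNF (k : ℕ) (φ : CNF) : (renameCNF k φ).length = φ.length := by
  induction φ with
  | nil => rfl
  | cons c φ ih => simp [renameCNF, ih]

theorem mem_renameClause {k : ℕ} {rest : List Literal} {c : Clause} {l : Literal}
    (hl : l ∈ c) : ∃ j, ⟨copyVar j l.var, l.pos⟩ ∈ renameClause k rest c := by
  induction c with
  | nil => cases hl
  | cons l' c ih =>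
    obtain rfl | hl := List.mem_cons.1 hl
    · exact ⟨_, List.mem_cons_self⟩
    · obtain ⟨j, hj⟩ := ih hl
      exact ⟨j, List.mem_cons_of_mem _ hj⟩

theorem exists_of_mem_renameClause {k : ℕ} {rest : List Literal} {c : Clause} {l : Literal}
    (hl : l ∈ renameClause k rest c) :
    ∃ l' ∈ c, ∃ j, j < (varsOf (c ++ rest)).count l'.var ∧ l = ⟨copyVar j l'.var, l'.pos⟩ := by
  induction c with
  | nil => cases hl
  | cons l' c ih =>
    obtain rfl | hl := List.mem_cons.1 hl
    · refine ⟨l', List.mem_cons_self, _, ?_, rfl⟩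
      simp only [varsOf, List.cons_append, List.map_cons, List.count_cons_self]
      omega
    · obtain ⟨l'', hmem, j, hj, hl⟩ := ih hl
      exact ⟨l'', List.mem_cons_of_mem _ hmem, j, hj.trans_le List.count_le_count_cons, hl⟩

theorem mem_renameCNF {k : ℕ} {φ : CNF} {c : Clause} (hc : c ∈ φ) :
    ∃ rest, renameClause k rest c ∈ renameCNF k φ ∧
      ∀ v, (varsOf (c ++ rest)).count v ≤ occurrences φ v := by
  induction φ with
  | nil => cases hc
  | cons d φ ih =>
    obtain rfl | hc := List.mem_cons.1 hc
    · exact ⟨φ.flatten, List.mem_cons_self, fun v => le_rfl⟩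
    · obtain ⟨rest, hmem, hle⟩ := ih hc
      refine ⟨rest, List.mem_cons_of_mem _ hmem, fun v => (hle v).trans ?_⟩
      simp [occurrences]

theorem exists_of_mem_renameCNF {k : ℕ} {φ : CNF} {c : Clause} (hc : c ∈ renameCNF k φ) :
    ∃ d ∈ φ, ∃ rest, c = renameClause k rest d := by
  induction φ with
  | nil => cases hc
  | cons d φ ih =>
    obtain rfl | hc := List.mem_cons.1 hc
    · exact ⟨d, List.mem_cons_self, _, rfl⟩
    · obtain ⟨e, he, hce⟩ := ih hc
      exact ⟨e, List.mem_cons_of_mem _ he, hce⟩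

theorem IsTwoCNF.reduceCNF {φ : CNF} (h : IsTwoCNF φ) (k : ℕ) : IsTwoCNF (reduceCNF k φ) := by
  intro c hc
  obtain hc | hc := List.mem_append.1 hc
  · obtain ⟨d, hd, rest, rfl⟩ := exists_of_mem_renameCNF hc
    rw [length_renameClause]
    exact h d hd
  · obtain ⟨p, -, rfl⟩ := List.mem_map.1 hc
    exact le_rfl

theorem exists_copyVar_eq (σ : ℕ → Bool) : ∃ τ : ℕ → Bool, ∀ j v, τ (copyVar j v) = σ v := by
  refine ⟨Function.extend (fun p : ℕ × ℕ => copyVar p.1 p.2) (fun p => σ p.2) fun _ => false,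
    fun j v => Function.Injective.extend_apply ?_ _ _ (j, v)⟩
  rintro ⟨i, w⟩ ⟨j, v⟩ h
  exact Prod.ext (copyVar_inj h).1 (copyVar_inj h).2

theorem Satisfiable.reduceCNF {φ : CNF} (h : Satisfiable φ) (k : ℕ) :
    Satisfiable (reduceCNF k φ) := by
  obtain ⟨σ, hσ⟩ := h
  obtain ⟨τ, hτ⟩ := exists_copyVar_eq σ
  refine ⟨τ, fun c hc => ?_⟩
  obtain hc | hc := List.mem_append.1 hc
  · obtain ⟨d, hd, rest, rfl⟩ := exists_of_mem_renameCNF hc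
    obtain ⟨l, hl, hlσ⟩ := hσ d hd
    obtain ⟨j, hj⟩ := mem_renameClause (k := k) (rest := rest) hl
    exact ⟨_, hj, (hτ _ _).trans hlσ⟩
  · obtain ⟨⟨v, t⟩, -, rfl⟩ := List.mem_map.1 hc
    cases hv : σ v with
    | false => exact ⟨⟨copyVar t v, false⟩, by simp [implClause], (hτ _ _).trans hv⟩
    | true => exact ⟨⟨copyVar ((t + 1) % k) v, true⟩, by simp [implClause], (hτ _ _).trans hv⟩

theorem imp_of_cyclic_imp {k : ℕ} {p : ℕ → Prop} (h : ∀ t < k, p t → p ((t + 1) % k))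
    {i j : ℕ} (hi : i < k) (hj : j < k) (hp : p i) : p j := by
  have hstep (n : ℕ) : p ((i + n) % k) := by
    induction n with
    | zero => rwa [Nat.add_zero, Nat.mod_eq_of_lt hi]
    | succ n ih =>
      have hnext := h _ (Nat.mod_lt _ (by omega)) ih
      rwa [Nat.mod_add_mod] at hnext
  have hturn := hstep (k - i + j)
  rwa [show i + (k - i + j) = k + j by omega, Nat.add_mod_left, Nat.mod_eq_of_lt hj] at hturn

theorem eq_copyVar_of_satisfies_cyclesCNF {k : ℕ} {vs : List ℕ} {τ : ℕ → Bool}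
    (hτ : ∀ c ∈ cyclesCNF k vs, ∃ l ∈ c, τ l.var = l.pos) {v : ℕ} (hv : v ∈ vs) {i j : ℕ}
    (hi : i < k) (hj : j < k) : τ (copyVar i v) = τ (copyVar j v) := by
  have himp : ∀ t < k, τ (copyVar t v) = true → τ (copyVar ((t + 1) % k) v) = true := by
    intro t ht htrue
    obtain ⟨l, hl, hτl⟩ := hτ (implClause k (v, t)) (List.mem_map_of_mem (by simp [hv, ht]))
    simp only [implClause, List.mem_cons, List.not_mem_nil, or_false] at hl
    obtain rfl | rfl := hl
    · simp [htrue] at hτl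
    · exact hτl
  exact Bool.eq_iff_iff.2 ⟨imp_of_cyclic_imp himp hi hj, imp_of_cyclic_imp himp hj hi⟩

theorem satisfiable_of_reduceCNF {k : ℕ} {φ : CNF} (hk : ∀ v, occurrences φ v ≤ k)
    (h : Satisfiable (reduceCNF k φ)) : Satisfiable φ := by
  obtain ⟨τ, hτ⟩ := h
  refine ⟨fun v => τ (copyVar 0 v), fun c hc => ?_⟩
  obtain ⟨rest, hmem, hle⟩ := mem_renameCNF (k := k) hc
  obtain ⟨l, hl, hτl⟩ := hτ _ (List.mem_append_left _ hmem)
  obtain ⟨l', hl', j, hj, rfl⟩ := exists_of_mem_renameClause hl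
  have hv : l'.var ∈ varsOf φ.flatten := List.mem_map_of_mem (List.mem_flatten_of_mem hc hl')
  have hjk : j < k := hj.trans_le ((hle _).trans (hk _))
  refine ⟨l', hl', Eq.trans ?_ hτl⟩
  exact eq_copyVar_of_satisfies_cyclesCNF (fun d hd => hτ d (List.mem_append_right _ hd)) hv
    (Nat.zero_lt_of_lt hjk) hjk

theorem satisfiable_reduceCNF_iff {k : ℕ} {φ : CNF} (hk : ∀ v, occurrences φ v ≤ k) :
    Satisfiable (reduceCNF k φ) ↔ Satisfiable φ :=
  ⟨satisfiable_of_reduceCNF hk, fun h => h.reduceCNF k⟩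

/-! ## The size parameters -/

theorem numVars_le {φ : CNF} (h : IsTwoCNF φ) : numVars φ ≤ 2 * numClauses φ := by
  calc numVars φ ≤ (φ.map List.length).sum := by
        rw [numVars, ← List.length_flatten, ← List.length_map Literal.var]
        exact List.toFinset_card_le _
    _ ≤ (φ.map List.length).length • 2 :=
        List.sum_le_card_nsmul _ _ (List.forall_mem_map.2 h)
    _ = 2 * numClauses φ := by rw [List.length_map, smul_eq_mul, mul_comm, numClauses]

theorem numClauses_le_length_flatten {φ : CNF} (h : [] ∉ φ) :
    numClauses φ ≤ φ.flatten.length := by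
  have hpos : ∀ n ∈ φ.map List.length, 1 ≤ n :=
    List.forall_mem_map.2 fun c hc => List.length_pos_iff.2 fun hnil => h (hnil ▸ hc)
  simpa [numClauses, List.length_flatten] using List.card_nsmul_le_sum _ _ hpos

theorem numClauses_le {k : ℕ} {φ : CNF} (h : [] ∉ φ) (hk : ∀ v, occurrences φ v ≤ k) :
    numClauses φ ≤ k * numVars φ := by
  calc numClauses φ ≤ (φ.flatten.map Literal.var).length := by
        rw [List.length_map]
        exact numClauses_le_length_flatten h
    _ = ∑ v ∈ (φ.flatten.map Literal.var).toFinset, occurrences φ v :=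
        (List.sum_toFinset_count_eq_length _).symm
    _ ≤ numVars φ • k := Finset.sum_le_card_nsmul _ _ _ fun v _ => hk v
    _ = k * numVars φ := by rw [smul_eq_mul, mul_comm]

theorem numClauses_reduceCNF (k : ℕ) (φ : CNF) :
    numClauses (reduceCNF k φ) = numClauses φ + numVars φ * k := by
  rw [numClauses, reduceCNF, List.length_append, length_renameCNF, cyclesCNF, List.length_map,
    List.length_product, List.length_range, numClauses, numVars, List.card_toFinset, varsOf]

theorem exists_of_mem_varsOf_reduceCNF {k u : ℕ} {φ : CNF} (hk : ∀ v, occurrences φ v ≤ k)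
    (hu : u ∈ varsOf (reduceCNF k φ).flatten) :
    ∃ j v, v ∈ varsOf φ.flatten ∧ j < k ∧ u = copyVar j v := by
  rw [reduceCNF, List.flatten_append, varsOf_append, List.mem_append, varsOf_renameCNF] at hu
  obtain hu | hu := hu
  · obtain ⟨j, v, hv, hj, rfl⟩ := exists_of_mem_renameVars hu
    exact ⟨j, v, hv, hj.trans_le (hk v), rfl⟩
  · exact exists_of_mem_varsOf_cyclesCNF hu

theorem numVars_reduceCNF_le {k : ℕ} {φ : CNF} (hk : ∀ v, occurrences φ v ≤ k) :
    numVars (reduceCNF k φ) ≤ numVars φ * k := by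
  have hsub : (varsOf (reduceCNF k φ).flatten).toFinset ⊆
      ((varsOf φ.flatten).toFinset ×ˢ Finset.range k).image fun p => copyVar p.2 p.1 := by
    intro u hu
    obtain ⟨j, v, hv, hj, rfl⟩ := exists_of_mem_varsOf_reduceCNF hk (List.mem_toFinset.1 hu)
    exact Finset.mem_image.2 ⟨(v, j), by simp [hv, hj], rfl⟩
  calc numVars (reduceCNF k φ)
      ≤ ((varsOf φ.flatten).toFinset ×ˢ Finset.range k).card :=
        (Finset.card_le_card hsub).trans Finset.card_image_le
    _ = numVars φ * k := by rw [Finset.card_product, Finset.card_range, numVars, varsOf]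

theorem size_reduceCNF_le {k : ℕ} {φ : CNF} (h : OneOrTwo φ) (hk : ∀ v, occurrences φ v ≤ k)
    {g g' : CNF → ℕ} (hg : g ∈ ({numVars, numClauses} : Set (CNF → ℕ)))
    (hg' : g' ∈ ({numVars, numClauses} : Set (CNF → ℕ))) :
    g' (reduceCNF k φ) ≤ (2 * k + 1) * g φ := by
  have hvars := numVars_le fun c hc => (h c hc).2
  have hclauses := numClauses_le (fun hnil => (h [] hnil).1 rfl) hk
  have hvars' := numVars_reduceCNF_le hk
  have hclauses' := numClauses_reduceCNF k φ
  obtain rfl | rfl := hg <;> obtain rfl | rfl := hg' <;> nlinarith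

/-! ## The reductions between the problems -/

theorem mem_twoSAT_iff_reduction_mem (k : ℕ) {k' : ℕ} (hk' : 3 ≤ k') (x : List Sym) :
    x ∈ twoSAT k ↔ reduction k x ∈ twoSAT k' := by
  by_cases hx : ∃ φ, OneOrTwo φ ∧ (∀ v, occurrences φ v ≤ k) ∧ encode φ = x
  · obtain ⟨φ, hφ, hk, rfl⟩ := hx
    have htwo : IsTwoCNF φ := fun c hc => (hφ c hc).2
    have hocc (v : ℕ) := (occurrences_reduceCNF_le hk v).trans hk'
    have hmem {n : ℕ} {ψ : CNF} (hψ : IsTwoCNF ψ) (hn : ∀ v, occurrences ψ v ≤ n) :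
        encode ψ ∈ twoSAT n ↔ Satisfiable ψ :=
      ⟨fun ⟨_, hcode, _, hsat, _⟩ => encode_injective hcode ▸ hsat,
        fun hsat => ⟨ψ, rfl, hψ, hsat, hn⟩⟩
    rw [reduction_encode hφ hk, hmem htwo hk, hmem (htwo.reduceCNF k) hocc,
      satisfiable_reduceCNF_iff hk]
  · refine iff_of_false ?_ ?_
    · rintro ⟨φ, hcode, htwo, hsat, hk⟩
      exact hx ⟨φ, htwo.oneOrTwo hsat, hk, hcode⟩
    · rintro ⟨ψ, hcode, -⟩
      exact encode_ne_reduction (fun φ hφ hk hcode => hx ⟨φ, hφ, hk, hcode⟩) ψ hcode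

theorem onStrings_reduction_le (k : ℕ) {g g' : CNF → ℕ}
    (hg : g ∈ ({numVars, numClauses} : Set (CNF → ℕ)))
    (hg' : g' ∈ ({numVars, numClauses} : Set (CNF → ℕ))) (x : List Sym) :
    onStrings g' (reduction k x) ≤ (2 * k + 1) * onStrings g x := by
  by_cases hx : ∃ φ, OneOrTwo φ ∧ (∀ v, occurrences φ v ≤ k) ∧ encode φ = x
  · obtain ⟨φ, hφ, hk, rfl⟩ := hx
    rw [reduction_encode hφ hk, onStrings_encode, onStrings_encode]
    exact size_reduceCNF_le hφ hk hg hg'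
  · rw [onStrings_of_not_code]
    · exact Nat.zero_le _
    · rintro ⟨ψ, hcode⟩
      exact encode_ne_reduction (fun φ hφ hk hcode => hx ⟨φ, hφ, hk, hcode⟩) ψ hcode

theorem shortReducible_twoSAT (k : ℕ) {k' : ℕ} (hk' : 3 ≤ k') {g g' : CNF → ℕ}
    (hg : g ∈ ({numVars, numClauses} : Set (CNF → ℕ)))
    (hg' : g' ∈ ({numVars, numClauses} : Set (CNF → ℕ))) :
    ShortReducible ⟨twoSAT k, onStrings g⟩ ⟨twoSAT k', onStrings g'⟩ :=
  ⟨reduction k, fl_reduction k, 2 * k + 1, Nat.succ_pos _, fun x =>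
    ⟨mem_twoSAT_iff_reduction_mem k hk' x,
      (onStrings_reduction_le k hg hg' x).trans (Nat.le_add_right _ _)⟩⟩

end TwoSat

theorem mainTheorem12_general {m m' : List TwoSat.Sym → ℕ}
    (hm : m ∈ ({TwoSat.mVbl, TwoSat.mCls} : Set (List TwoSat.Sym → ℕ)))
    (hm' : m' ∈ ({TwoSat.mVbl, TwoSat.mCls} : Set (List TwoSat.Sym → ℕ)))
    (k : ℕ) {k' : ℕ} (hk' : 3 ≤ k') :
    LogSpace.ShortReducible ⟨TwoSat.twoSAT k, m⟩ ⟨TwoSat.twoSAT k', m'⟩ := by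
  obtain rfl | rfl := hm <;> obtain rfl | rfl := hm' <;>
    exact TwoSat.shortReducible_twoSAT k hk' (by simp) (by simp)

theorem mainTheorem12 :
    (∀ m ∈ ({TwoSat.mVbl, TwoSat.mCls} : Set (List TwoSat.Sym → ℕ)), ∀ k : ℕ, 3 ≤ k →
      LogSpace.ShortEquiv ⟨TwoSat.twoSAT k, m⟩ ⟨TwoSat.twoSAT 3, m⟩) ∧
    LogSpace.ShortEquiv ⟨TwoSat.twoSAT 3, TwoSat.mVbl⟩ ⟨TwoSat.twoSAT 3, TwoSat.mCls⟩ :=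
  ⟨fun _ hm k hk =>
      ⟨mainTheorem12_general hm hm k le_rfl, mainTheorem12_general hm hm 3 hk⟩,
    mainTheorem12_general (.inl rfl) (.inr rfl) 3 le_rfl,
    mainTheorem12_general (.inr rfl) (.inl rfl) 3 le_rfl⟩
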